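/- Let $a_n>0$ and $b_n\in\mathbb R$ ($n\ge 0$) be such that $$\lim_{n\to\infty}\bigl(a_n-\tfrac12\bigr)=\lim_{n\to\infty}b_n=0,\qquad \sum_{n=0}^\infty\bigl(|a_{n+1}-a_n|+|b_{n+1}-b_n|\bigr)<\infty ,$$ and put $\varepsilon_n=\sum_{m=n}^\infty(|a_{m+1}-a_m|+|b_{m+1}-b_m|)$. Let $J$ be the bounded self-adjoint Jacobi operator in $\ell^2(\mathbb Z_+)$ with diagonal entries $b_n$ and off-diagonal entries $a_n$, let $E(\lambda)$ be its spectral family and $d\rho(\lambda)=d(E(\lambda)e_0,e_0)$ its spectral measure, where $e_0=(1,0,0,\dots)$. Set $a_{-1}=\frac12$, and let $P_n$ be the orthogonal polynomials of $J$: $P_{-1}=0$, $P_0=1$ and $a_{n-1}P_{n-1}(\lambda)+b_nP_n(\lambda)+a_nP_{n+1}(\lambda)=\lambda P_n(\lambda)$ for $n\ge0$. Let $\zeta(z)=z-\sqrt{z^2-1}$, $z\in\mathbb C\setminus[-1,1]$, with $\sqrt{z^2-1}>0$ for $z>1$, and let $\zeta(x\pm i0)$ be its boundary values at $x\in\mathbb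 R$ from the upper and lower half-planes. For $\lambda\in(-1,1)$ set $\lambda_n=(\lambda-b_n)/(2a_n)$; let $\theta_n(\lambda)=\arccos\lambda_n$ if $|\lambda_n|<1$, $\theta_n(\lambda)=0$ if $\lambda_n\ge1$ and $\theta_n(\lambda)=\pi$ if $\lambda_n\le-1$; and let $$\varphi_n(\lambda)=\sum_{m=0}^{n-1}\theta_m(\lambda),\qquad q_n(\lambda\pm i0)=\prod_{m=0}^{n-1}\zeta(\lambda_m\pm i0),\qquad k(\lambda)=\prod_{m=0}^\infty|\zeta(\lambda_m\pm i0)|$$ (only finitely many factors of the last product differ from $1$, and it does not depend on the sign). Then: 1. For every $\lambda\in(-1,1)$ and each sign, the equation $a_{n-1}f_{n-1}+b_nf_n+a_nf_{n+1}=\lambda f_n$, $n\ge 0$, has exactly one solution $(f_n(\lambda\pm i0))_{n\ge-1}$ with $f_n(\lambda\pm i0)=q_n(\lambda\pm i0)(1+o(1))$ as $n\to\infty$. Put $\mathbf f_n=k^{-1}f_n$ and let $\boldsymbol\Omega(\lambda\pm i0)=\{P(\lambda),\mathbf f(\lambda\pm i0)\}$, where $\{f,g\}=a_n(f_ng_{n+1}-f_{n+1}g_n)$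 is the Wronskian, which does not depend on $n\ge-1$ for solutions $f$, $g$ of this equation. There is a function $\eta$ on $(-1,1)$ with $$-2\,\boldsymbol\Omega(\lambda\pm i0)=\varkappa(\lambda)e^{\pm i\eta(\lambda)},\qquad \varkappa(\lambda)=2|\boldsymbol\Omega(\lambda+i0)|>0,$$ and $\eta(\lambda)$ is determined by this up to an integer multiple of $2\pi$. 2. On $(-1,1)$ the function $\lambda\mapsto(E(\lambda)e_0,e_0)$ is differentiable with derivative $w(\lambda)>0$, and $d\rho(\lambda)=w(\lambda)\,d\lambda$ there. 3. For any such $\eta$, $$P_n(\lambda)=\Bigl(\frac2\pi\Bigr)^{1/2}(1-\lambda^2)^{-1/4}\,w(\lambda)^{-1/2}\sin\bigl(\varphi_n(\lambda)+\eta(\lambda)\bigr)+O(\varepsilon_n),\qquad n\to\infty,$$ uniformly in $\lambda$ on every compact subinterval of $(-1,1)$. -/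

import Mathlib

open Filter Topology MeasureTheory Set
open scoped CompactlySupported ENNReal

section SpectralMeasure

/-- For an operator `T` and a vector `e` of a complex Hilbert space, the positive linear
functional `f ↦ (f(T) e, e)`, where `f(T)` is the continuous functional calculus of `T` if `T` is
bounded and self-adjoint. -/
noncomputable def spectralFunctional {H : Type*} [NormedAddCommGroup H] [InnerProductSpace ℂ H]
    [CompleteSpace H] (T : H →L[ℂ] H) (e : H) : C_c(ℝ, ℝ) →ₚ[ℝ] ℝ :=
  PositiveLinearMap.mk₀
    { toFun := fun f => (inner ℂ e (cfc (fun x => f x) T e)).re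
      map_add' := fun f g => by
        have h : cfc (fun x => (f + g) x) T = cfc (fun x => f x) T + cfc (fun x => g x) T :=
          cfc_add (a := T) (fun x => f x) (fun x => g x)
            (map_continuous f).continuousOn (map_continuous g).continuousOn
        rw [h]
        simp
      map_smul' := fun r f => by
        have h : cfc (fun x => (r • f) x) T = r • cfc (fun x => f x) T :=
          cfc_smul (a := T) r (fun x => f x) (map_continuous f).continuousOn
        rw [h]
        simp [inner_smul_right_eq_smul] }
    (fun f hf => by
      have h : 0 ≤ cfc (fun x => f x) T := cfc_nonneg fun x _ => hf x
      rw [ContinuousLinearMap.nonneg_iff_isPositive] at h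
      exact h.re_inner_nonneg_right _)

/-- The spectral measure `d(E(λ) e, e)` of a bounded self-adjoint operator `T` with spectral
family `E` at a vector `e`: the regular measure on `ℝ` with `∫ f dρ = (f(T) e, e)` for all
continuous `f` with compact support. -/
noncomputable def vectorSpectralMeasure {H : Type*} [NormedAddCommGroup H]
    [InnerProductSpace ℂ H] [CompleteSpace H] (T : H →L[ℂ] H) (e : H) : Measure ℝ :=
  RealRMK.rieszMeasure (spectralFunctional T e)

theorem integral_vectorSpectralMeasure {H : Type*} [NormedAddCommGroup H]
    [InnerProductSpace ℂ H] [CompleteSpace H] (T : H →L[ℂ] H) (e : H) (f : C_c(ℝ, ℝ)) :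
    ∫ x, f x ∂(vectorSpectralMeasure T e) = (inner ℂ e (cfc (fun x => f x) T e)).re :=
  RealRMK.integral_rieszMeasure (spectralFunctional T e) f

end SpectralMeasure

/-- The complex Hilbert space `ℓ²(ℤ₊)`. -/
abbrev EllTwo : Type := lp (fun _ : ℕ => ℂ) 2

namespace EllTwo

theorem memlp_mul {c : ℕ → ℝ} {C : ℝ} (hc : ∀ n, |c n| ≤ C) (u : EllTwo) :
    Memℓp (fun n => (c n : ℂ) * u n) 2 := by
  have h := (lp.memℓp u).norm.const_mul C
  refine Memℓp.mono h fun n => ?_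
  rw [norm_mul, Complex.norm_real, Real.norm_eq_abs]
  exact mul_le_mul_of_nonneg_right (hc n) (norm_nonneg _)

/-- The bounded operator of multiplication by a bounded real sequence `c`. -/
noncomputable def diag (c : ℕ → ℝ) (hc : ∃ C, ∀ n, |c n| ≤ C) : EllTwo →L[ℂ] EllTwo :=
  LinearMap.mkContinuousOfExistsBound
    { toFun := fun u => ⟨fun n => (c n : ℂ) * u n, memlp_mul hc.choose_spec u⟩
      map_add' := fun u v => by
        ext n
        exact mul_add _ _ _
      map_smul' := fun r u => by
        ext n
        simp [mul_left_comm] }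
    (by
      obtain ⟨C, hC⟩ := hc
      have hC0 : 0 ≤ C := (abs_nonneg _).trans (hC 0)
      refine ⟨C, fun u => ?_⟩
      have h2 : 0 < (2 : ℝ≥0∞).toReal := by simp
      refine lp.norm_le_of_forall_sum_le h2 (mul_nonneg hC0 (norm_nonneg _)) fun s => ?_
      rw [Real.mul_rpow hC0 (norm_nonneg _)]
      refine le_trans ?_ (mul_le_mul_of_nonneg_left (lp.sum_rpow_le_norm_rpow h2 u s)
        (Real.rpow_nonneg hC0 _))
      rw [Finset.mul_sum]
      refine Finset.sum_le_sum fun n _ => ?_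
      rw [← Real.mul_rpow hC0 (norm_nonneg _)]
      refine Real.rpow_le_rpow (norm_nonneg _) ?_ h2.le
      show ‖(c n : ℂ) * u n‖ ≤ _
      rw [norm_mul, Complex.norm_real, Real.norm_eq_abs]
      exact mul_le_mul_of_nonneg_right (hC n) (norm_nonneg _))

@[simp] theorem diag_apply (c : ℕ → ℝ) (hc : ∃ C, ∀ n, |c n| ≤ C) (u : EllTwo) (n : ℕ) :
    diag c hc u n = (c n : ℂ) * u n := rfl

/-- The left shift `(u_0, u_1, u_2, …) ↦ (u_1, u_2, …)`. -/
noncomputable def leftShift : EllTwo →L[ℂ] EllTwo :=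
  LinearMap.mkContinuous
    { toFun := fun u => ⟨fun n => u (n + 1), by
        have h2 : 0 < (2 : ℝ≥0∞).toReal := by simp
        exact memℓp_gen ((summable_nat_add_iff 1).2 ((lp.memℓp u).summable h2))⟩
      map_add' := fun u v => rfl
      map_smul' := fun r u => rfl }
    1
    (fun u => by
      have h2 : 0 < (2 : ℝ≥0∞).toReal := by simp
      rw [one_mul]
      refine lp.norm_le_of_forall_sum_le h2 (norm_nonneg _) fun s => ?_
      refine le_trans (le_of_eq ?_)
        (lp.sum_rpow_le_norm_rpow h2 u (s.map (addRightEmbedding 1)))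
      rw [Finset.sum_map]
      rfl)

@[simp] theorem leftShift_apply (u : EllTwo) (n : ℕ) : leftShift u n = u (n + 1) := rfl

/-- The canonical basis vector `e_n`. -/
noncomputable def basisVec (n : ℕ) : EllTwo := lp.single 2 n (1 : ℂ)

end EllTwo

/-- The entries of a bounded Jacobi matrix: off-diagonal `a_n > 0` and diagonal real `b_n`,
`n = 0, 1, 2, …`. -/
structure JacobiMatrix where
  a : ℕ → ℝ
  b : ℕ → ℝ
  a_pos : ∀ n, 0 < a n
  a_bdd : ∃ C, ∀ n, |a n| ≤ C
  b_bdd : ∃ C, ∀ n, |b n| ≤ C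

namespace JacobiMatrix

/-! ### The Jacobi operator and its spectral measure -/

/-- The Jacobi operator in `ℓ²(ℤ₊)`: the symmetric tridiagonal matrix with diagonal `b` and
off-diagonals `a`.  Its action on coordinates is computed in `op_apply_zero`, `op_apply_succ`. -/
noncomputable def op (J : JacobiMatrix) : EllTwo →L[ℂ] EllTwo :=
  EllTwo.diag J.b J.b_bdd + EllTwo.diag J.a J.a_bdd * EllTwo.leftShift +
    star (EllTwo.diag J.a J.a_bdd * EllTwo.leftShift)

theorem diag_selfAdjoint (c : ℕ → ℝ) (hc : ∃ C, ∀ n, |c n| ≤ C) :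
    IsSelfAdjoint (EllTwo.diag c hc) := by
  rw [ContinuousLinearMap.isSelfAdjoint_iff_isSymmetric]
  intro u v
  simp only [ContinuousLinearMap.coe_coe, lp.inner_eq_tsum, EllTwo.diag_apply]
  refine tsum_congr fun n => ?_
  simp only [RCLike.inner_apply, map_mul, Complex.conj_ofReal]
  ring

theorem op_isSelfAdjoint (J : JacobiMatrix) : IsSelfAdjoint J.op := by
  have h := diag_selfAdjoint J.b J.b_bdd
  unfold op
  rw [add_assoc]
  exact h.add (IsSelfAdjoint.add_star_self _)

theorem op_coord (J : JacobiMatrix) (u : EllTwo) (n : ℕ) :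
    J.op u n = (J.b n : ℂ) * u n + J.a n * u (n + 1) +
      inner ℂ ((EllTwo.diag J.a J.a_bdd * EllTwo.leftShift) (EllTwo.basisVec n)) u := by
  have h : star (EllTwo.diag J.a J.a_bdd * EllTwo.leftShift) u n =
      inner ℂ (EllTwo.basisVec n)
        (star (EllTwo.diag J.a J.a_bdd * EllTwo.leftShift) u) := by
    rw [EllTwo.basisVec, lp.inner_single_left]
    simp [RCLike.inner_apply]
  rw [ContinuousLinearMap.star_eq_adjoint, ContinuousLinearMap.adjoint_inner_right] at h
  rw [← h]
  simp [op, ContinuousLinearMap.star_eq_adjoint]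

theorem op_apply_zero (J : JacobiMatrix) (u : EllTwo) :
    J.op u 0 = J.b 0 * u 0 + J.a 0 * u 1 := by
  have h : (EllTwo.diag J.a J.a_bdd * EllTwo.leftShift) (EllTwo.basisVec 0) = 0 := by
    ext k
    simp [EllTwo.basisVec, lp.single_apply]
  rw [op_coord, h]
  simp

theorem op_apply_succ (J : JacobiMatrix) (u : EllTwo) (n : ℕ) :
    J.op u (n + 1) = J.a n * u n + J.b (n + 1) * u (n + 1) + J.a (n + 1) * u (n + 2) := by
  have h : (EllTwo.diag J.a J.a_bdd * EllTwo.leftShift) (EllTwo.basisVec (n + 1)) =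
      lp.single 2 n (J.a n : ℂ) := by
    ext k
    by_cases hk : k = n
    · subst hk
      simp [EllTwo.basisVec]
    · simp [EllTwo.basisVec, lp.single_apply, hk]
  rw [op_coord, h, lp.inner_single_left]
  simp [RCLike.inner_apply]
  ring

/-- The spectral measure `dρ(λ) = d(E(λ) e_0, e_0)` of the Jacobi operator. -/
noncomputable def spectralMeasure (J : JacobiMatrix) : Measure ℝ :=
  vectorSpectralMeasure J.op (EllTwo.basisVec 0)

/-- The function `λ ↦ (E(λ) e_0, e_0) = ρ((-∞, λ])`. -/
noncomputable def spectralDistribution (J : JacobiMatrix) (x : ℝ) : ℝ :=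
  (J.spectralMeasure (Iic x)).toReal

/-- The weight `w(λ) = d(E(λ) e_0, e_0) / dλ`. -/
noncomputable def weight (J : JacobiMatrix) (x : ℝ) : ℝ :=
  deriv J.spectralDistribution x

/-! ### Orthogonal polynomials -/

/-- The orthogonal polynomials: `P_{-1} = 0`, `P_0 = 1`,
`a_{n-1} P_{n-1} + b_n P_n + a_n P_{n+1} = z P_n`. -/
noncomputable def orthPoly (J : JacobiMatrix) : ℕ → Polynomial ℝ
  | 0 => 1
  | 1 => Polynomial.C (J.a 0)⁻¹ * (Polynomial.X - Polynomial.C (J.b 0))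
  | n + 2 => Polynomial.C (J.a (n + 1))⁻¹ *
      ((Polynomial.X - Polynomial.C (J.b (n + 1))) * orthPoly J (n + 1) -
        Polynomial.C (J.a n) * orthPoly J n)

/-! ### Solutions of the Jacobi equation

A sequence `(f_n)_{n ≥ -1}` is stored with its index shifted by one: `f k` stands for
`f_{k-1}`, so that `f 0` is `f_{-1}`. -/

/-- The coefficients `a_{k-1}`, with the convention `a_{-1} = 1/2`. -/
noncomputable def aShift (J : JacobiMatrix) : ℕ → ℝ
  | 0 => 1 / 2
  | k + 1 => J.a k

/-- `a_{n-1} f_{n-1} + b_n f_n + a_n f_{n+1} = z f_n` for all `n ≥ 0`. -/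
def IsSolution (J : JacobiMatrix) (z : ℂ) (f : ℕ → ℂ) : Prop :=
  ∀ n, J.aShift n * f n + J.b n * f (n + 1) + J.aShift (n + 1) * f (n + 2) = z * f (n + 1)

/-- The Wronskian `a_n (f_n g_{n+1} - f_{n+1} g_n)`, taken at `n = -1`; for two solutions of the
same Jacobi equation it does not depend on `n`, see `wronskian_eq`. -/
noncomputable def wronskian (J : JacobiMatrix) (f g : ℕ → ℂ) : ℂ :=
  J.aShift 0 * (f 0 * g 1 - f 1 * g 0)

theorem wronskian_eq (J : JacobiMatrix) {z : ℂ} {f g : ℕ → ℂ} (hf : J.IsSolution z f)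
    (hg : J.IsSolution z g) (n : ℕ) :
    J.aShift n * (f n * g (n + 1) - f (n + 1) * g n) = J.wronskian f g := by
  induction n with
  | zero => rfl
  | succ n ih =>
    rw [← ih]
    linear_combination f (n + 1) * hg n - g (n + 1) * hf n

/-- The solution `(P_n(λ))_{n ≥ -1}`. -/
noncomputable def polySol (J : JacobiMatrix) (x : ℝ) : ℕ → ℂ
  | 0 => 0
  | n + 1 => ((J.orthPoly n).eval x : ℝ)

theorem polySol_isSolution (J : JacobiMatrix) (x : ℝ) : J.IsSolution x (J.polySol x) := by
  intro n
  rcases n with _ | n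
  · have h : (J.a 0 : ℂ) ≠ 0 := by exact_mod_cast (J.a_pos 0).ne'
    simp [polySol, orthPoly, aShift]
    field_simp
    ring
  · have h : (J.a (n + 1) : ℂ) ≠ 0 := by exact_mod_cast (J.a_pos (n + 1)).ne'
    simp [polySol, orthPoly, aShift]
    field_simp
    ring

/-! ### The Jost solutions on the two edges of the cut -/

/-- The two edges `λ + i0` and `λ - i0` of the real line. -/
inductive Edge
  | plus
  | minus

/-- `+1` on the upper edge and `-1` on the lower edge. -/
def Edge.sign : Edge → ℝ
  | .plus => 1
  | .minus => -1

/-- The boundary value at `x ± i0` of the branch of `√(z² - 1)` on `ℂ ∖ [-1, 1]` that is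
positive for `z > 1`: it is `± i √(1 - x²)` on `[-1, 1]`, positive for `x > 1` and negative for
`x < -1`. -/
noncomputable def edgeSqrt (s : Edge) (x : ℝ) : ℂ :=
  if |x| ≤ 1 then s.sign * Complex.I * Real.sqrt (1 - x ^ 2)
  else if 1 < x then Real.sqrt (x ^ 2 - 1) else -Real.sqrt (x ^ 2 - 1)

/-- `ζ(x ± i0)`, where `ζ(z) = z - √(z² - 1)`. -/
noncomputable def edgeZeta (s : Edge) (x : ℝ) : ℂ := x - edgeSqrt s x

/-- `λ_n = (λ - b_n) / (2 a_n)`. -/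
noncomputable def lam (J : JacobiMatrix) (x : ℝ) (n : ℕ) : ℝ := (x - J.b n) / (2 * J.a n)

/-- `q_n(λ ± i0) = ζ_0 ζ_1 ⋯ ζ_{n-1}` with `ζ_m = ζ(λ_m ± i0)`. -/
noncomputable def ansatz (J : JacobiMatrix) (s : Edge) (x : ℝ) (n : ℕ) : ℂ :=
  ∏ m ∈ Finset.range n, edgeZeta s (J.lam x m)

/-- `f` is the Jost solution at `λ ± i0`: it solves the Jacobi equation with `z = λ` and
`f_n = q_n(λ ± i0) (1 + o(1))` as `n → ∞`. -/
def IsJost (J : JacobiMatrix) (s : Edge) (x : ℝ) (f : ℕ → ℂ) : Prop :=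
  J.IsSolution x f ∧ Tendsto (fun n => f (n + 1) / J.ansatz s x n) atTop (𝓝 1)

open Classical in
/-- The Jost solution `(f_n(λ ± i0))_{n ≥ -1}` (and `0` if there is none). -/
noncomputable def jost (J : JacobiMatrix) (s : Edge) (x : ℝ) : ℕ → ℂ :=
  if h : ∃ f, J.IsJost s x f then h.choose else 0

/-- The normalizing factor `k(λ) = ∏_m |ζ(λ_m ± i0)|`, a product with finitely many factors
different from `1` for `λ ∈ (-1, 1)`.  It does not depend on the edge. -/
noncomputable def normFactor (J : JacobiMatrix) (x : ℝ) : ℝ :=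
  ∏ᶠ m, ‖edgeZeta Edge.plus (J.lam x m)‖

/-- The normalized Jost solution `𝐟(λ ± i0) = k(λ)⁻¹ f(λ ± i0)`. -/
noncomputable def normJost (J : JacobiMatrix) (s : Edge) (x : ℝ) (n : ℕ) : ℂ :=
  (J.normFactor x : ℂ)⁻¹ * J.jost s x n

/-- The Wronskian `𝛀(λ ± i0) = {P(λ), 𝐟(λ ± i0)}`. -/
noncomputable def Omega (J : JacobiMatrix) (s : Edge) (x : ℝ) : ℂ :=
  J.wronskian (J.polySol x) (J.normJost s x)

/-- The limit amplitude `ϰ(λ) = 2 |𝛀(λ + i0)|`. -/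
noncomputable def limitAmplitude (J : JacobiMatrix) (x : ℝ) : ℝ := 2 * ‖J.Omega Edge.plus x‖

/-- `η` is a limit phase on `(-1, 1)`: `-2 𝛀(λ ± i0) = ϰ(λ) e^{± i η(λ)}` with `ϰ(λ) > 0`.  This
determines each `η(λ)` up to an integer multiple of `2π`. -/
def IsLimitPhase (J : JacobiMatrix) (η : ℝ → ℝ) : Prop :=
  ∀ x ∈ Ioo (-1 : ℝ) 1, 0 < J.limitAmplitude x ∧
    ∀ s : Edge, -2 * J.Omega s x =
      J.limitAmplitude x * Complex.exp (s.sign * Complex.I * η x)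

/-! ### The phases and the remainder -/

/-- `θ_n(λ) = arccos λ_n`, with `θ_n = 0` for `λ_n ≥ 1` and `θ_n = π` for `λ_n ≤ -1`
(the values which `Real.arccos` takes there). -/
noncomputable def theta (J : JacobiMatrix) (x : ℝ) (n : ℕ) : ℝ := Real.arccos (J.lam x n)

/-- `φ_n(λ) = θ_0(λ) + ⋯ + θ_{n-1}(λ)`. -/
noncomputable def phase (J : JacobiMatrix) (x : ℝ) (n : ℕ) : ℝ :=
  ∑ m ∈ Finset.range n, J.theta x m

/-- `|a_{n+1} - a_n| + |b_{n+1} - b_n|`. -/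
def variation (J : JacobiMatrix) (n : ℕ) : ℝ := |J.a (n + 1) - J.a n| + |J.b (n + 1) - J.b n|

/-- `ε_n = ∑_{m ≥ n} (|a_{m+1} - a_m| + |b_{m+1} - b_m|)`. -/
noncomputable def eps (J : JacobiMatrix) (n : ℕ) : ℝ := ∑' m, J.variation (n + m)

end JacobiMatrix

/-! The equation reads f_{n+2} = 2λ_{n+1} f_{n+1} - (a_n / a_{n+1}) f_n. For large n its
characteristic roots ζ(λ_n), ζ(λ_n)⁻¹ lie on the unit circle, stay apart uniformly on a compact
subinterval of (-1, 1), and have bounded variation in n. Variation of parameters turns it into a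
summable perturbation of a trivial recurrence, which yields the Jost solution with relative error
O(ε_n) (`exists_solution_of_slowly_varying`, `exists_jost_uniform`). The solution at the lower edge
is the complex conjugate, and the Wronskian of the normalized pair is i√(1-λ²). Expanding P_n over
the pair (`orthPoly_eq`) gives P_n = ϰ (1-λ²)^{-1/2} sin(φ_n + η) + O(ε_n), which is the claim up to
the form of the amplitude.

To relate ϰ to the weight, two limits of the Turán determinants D_n = P_{n+1}² - P_n P_{n+2} are
compared. By the asymptotics just found, D_n → ϰ² uniformly on compact subintervals
(`tendstoUniformlyOn_turan`). On the other hand ∫ f P_n P_m dρ = (f(J) e_m, e_n), and far out J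
looks like the matrix with a = 1/2, b = 0, so that ∫ f D_n dρ → (2/π) ∫ f √(1-x²) dx over (-1, 1)
(`tendsto_integral_turan`). Hence ϰ² dρ = (2/π) √(1-x²) dx on (-1, 1)
(`integral_spectralMeasure_eq`). This gives absolute continuity, the weight and the amplitude at
once, without boundary values of the resolvent. -/

/-! ### Functional calculus and the spectral measure of a vector -/

section SpectralMeasure

variable {H : Type*} [NormedAddCommGroup H] [InnerProductSpace ℂ H] [CompleteSpace H]

/-- The real part of the matrix element `(f(T) v, u)` of a function of `T`. -/
noncomputable def cfcForm (T : H →L[ℂ] H) (f : ℝ → ℝ) (u v : H) : ℝ :=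
  (inner ℂ u (cfc f T v)).re

theorem cfcForm_add (T : H →L[ℂ] H) {f g : ℝ → ℝ} (hf : Continuous f) (hg : Continuous g)
    (u v : H) : cfcForm T (fun x => f x + g x) u v = cfcForm T f u v + cfcForm T g u v := by
  have h : cfc (fun x => f x + g x) T = cfc f T + cfc g T :=
    cfc_add (a := T) f g hf.continuousOn hg.continuousOn
  simp only [cfcForm, h, add_apply, inner_add_right, Complex.add_re]

theorem abs_cfcForm_le (T : H →L[ℂ] H) {f : ℝ → ℝ} {C : ℝ} (hC : 0 ≤ C)
    (h : ∀ x ∈ spectrum ℝ T, |f x| ≤ C) (u v : H) : |cfcForm T f u v| ≤ ‖u‖ * (C * ‖v‖) := by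
  have hn : ‖cfc f T‖ ≤ C := norm_cfc_le hC h
  refine (Complex.abs_re_le_norm _).trans ((norm_inner_le_norm _ _).trans ?_)
  refine mul_le_mul_of_nonneg_left (((cfc f T).le_opNorm _).trans ?_) (norm_nonneg _)
  exact mul_le_mul_of_nonneg_right hn (norm_nonneg _)

theorem cfcForm_polynomial {T : H →L[ℂ] H} (hT : IsSelfAdjoint T) (p : Polynomial ℝ) (u v : H) :
    cfcForm T (fun x => p.eval x) u v = (inner ℂ u (Polynomial.aeval T p v)).re := by
  rw [cfcForm, cfc_polynomial _ _ hT]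

/-- The polynomials factor out of the calculus, and p(T), being self-adjoint, moves to the left of
the inner product. The factor f keeps the integrand compactly supported, as the measure is known
only through such functions. -/
theorem integral_vectorSpectralMeasure_mul_polynomial {T : H →L[ℂ] H} (hT : IsSelfAdjoint T)
    (e : H) (f : C_c(ℝ, ℝ)) (p q : Polynomial ℝ) :
    ∫ x, f x * (p.eval x * q.eval x) ∂(vectorSpectralMeasure T e) =
      cfcForm T f (Polynomial.aeval T p e) (Polynomial.aeval T q e) := by
  let g : C_c(ℝ, ℝ) :=
    { toFun := fun x => f x * (p.eval x * q.eval x)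
      continuous_toFun := (map_continuous f).mul (p.continuous.mul q.continuous)
      hasCompactSupport' := f.hasCompactSupport.mul_right }
  have h1 : ∀ p : Polynomial ℝ, ContinuousOn (fun x => p.eval x) (spectrum ℝ T) :=
    fun p => p.continuous.continuousOn
  have h2 : ContinuousOn (fun x => f x) (spectrum ℝ T) := (map_continuous f).continuousOn
  have h2' : ContinuousOn (fun x => f x * q.eval x) (spectrum ℝ T) := h2.mul (h1 q)
  have h3 : cfc (fun x => g x) T = cfc (fun x => p.eval x) T *
      (cfc (fun x => f x) T * cfc (fun x => q.eval x) T) := by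
    rw [← cfc_mul _ _ _ h2 (h1 q), ← cfc_mul _ _ _ (h1 p) h2']
    congr 1
    ext x
    change f x * (p.eval x * q.eval x) = _
    ring
  have h4 := integral_vectorSpectralMeasure T e g
  have h5 : IsSelfAdjoint (cfc (fun x => p.eval x) T) := cfc_predicate _ _
  rw [h3, mul_apply_eq_comp, mul_apply_eq_comp,
    ← ContinuousLinearMap.adjoint_inner_left, ContinuousLinearMap.isSelfAdjoint_iff'.1 h5,
    cfc_polynomial _ _ hT, cfc_polynomial _ _ hT] at h4
  exact h4

/-- A cutoff with values in [0, 1], equal to 1 on a ball, bounds the mass of the ball by ‖e‖²; the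
balls exhaust the line. -/
theorem vectorSpectralMeasure_univ_le (T : H →L[ℂ] H) (e : H) :
    vectorSpectralMeasure T e univ ≤ ENNReal.ofReal (‖e‖ ^ 2) := by
  have hK : ∀ r : ℕ, vectorSpectralMeasure T e (Metric.closedBall 0 r) ≤
      ENNReal.ofReal (‖e‖ ^ 2) := by
    intro r
    have hc : IsCompact (Metric.closedBall (0 : ℝ) r) := isCompact_closedBall _ _
    obtain ⟨f, hf1, -, hf3, hf4⟩ := exists_continuous_one_zero_of_isCompact hc
      (isClosed_empty) (disjoint_empty _)
    let g : C_c(ℝ, ℝ) := ⟨f, hf3⟩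
    refine (RealRMK.rieszMeasure_le_of_eq_one (spectralFunctional T e) (f := g)
      (fun x => (hf4 x).1) hc hf1).trans (ENNReal.ofReal_le_ofReal ?_)
    refine (le_abs_self _).trans ((abs_cfcForm_le T zero_le_one (fun x _ => ?_) e e).trans_eq ?_)
    · exact abs_le.2 ⟨neg_one_lt_zero.le.trans (hf4 x).1, (hf4 x).2⟩
    · ring
  rw [← Metric.iUnion_closedBall_nat (0 : ℝ)]
  rw [Monotone.measure_iUnion]
  · exact iSup_le hK
  · intro r s hrs
    exact Metric.closedBall_subset_closedBall (by exact_mod_cast hrs)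

end SpectralMeasure

/-! ### Matrix elements of functions of J and the weak limit of the Turán determinants -/

namespace EllTwo

theorem inner_basisVec_left (n : ℕ) (u : EllTwo) : inner ℂ (basisVec n) u = u n := by
  rw [basisVec, lp.inner_single_left]
  simp [RCLike.inner_apply]

theorem basisVec_apply (n k : ℕ) : basisVec n k = if k = n then 1 else 0 := by
  by_cases h : k = n
  · subst h; simp [basisVec]
  · simp [basisVec, h]

theorem coord_add (u v : EllTwo) (n : ℕ) : (u + v) n = u n + v n := rfl

theorem coord_smul (c : ℂ) (u : EllTwo) (n : ℕ) : (c • u) n = c * u n := rfl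

theorem norm_basisVec (n : ℕ) : ‖basisVec n‖ = 1 := by
  simp [basisVec, lp.norm_single]

end EllTwo

namespace JacobiMatrix

open EllTwo

variable (J : JacobiMatrix)

theorem op_basisVec_zero :
    J.op (basisVec 0) = (J.b 0 : ℂ) • basisVec 0 + (J.a 0 : ℂ) • basisVec 1 := by
  ext k
  rcases k with _ | _ | k
  · simp [op_apply_zero, basisVec_apply,
      coord_add, coord_smul, -lp.coeFn_add, -lp.coeFn_smul, -Complex.coe_smul]
  · simp [op_apply_succ, basisVec_apply,
      coord_add, coord_smul, -lp.coeFn_add, -lp.coeFn_smul, -Complex.coe_smul]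
  · simp [op_apply_succ, basisVec_apply,
      coord_add, coord_smul, -lp.coeFn_add, -lp.coeFn_smul, -Complex.coe_smul]

theorem op_basisVec_succ (n : ℕ) :
    J.op (basisVec (n + 1)) = (J.a n : ℂ) • basisVec n + (J.b (n + 1) : ℂ) • basisVec (n + 1) +
      (J.a (n + 1) : ℂ) • basisVec (n + 2) := by
  ext k
  rcases k with _ | k
  · rcases n with _ | n <;> simp [op_apply_zero, basisVec_apply,
      coord_add, coord_smul, -lp.coeFn_add, -lp.coeFn_smul, -Complex.coe_smul]
  · by_cases h1 : k = n + 1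
    · subst h1
      have h2 : ¬ n + 1 + 1 = n := by omega
      simp [h2, op_apply_succ, basisVec_apply,
        coord_add, coord_smul, -lp.coeFn_add, -lp.coeFn_smul, -Complex.coe_smul]
    · by_cases h2 : k = n
      · subst h2; simp [op_apply_succ, basisVec_apply,
          coord_add, coord_smul, -lp.coeFn_add, -lp.coeFn_smul, -Complex.coe_smul]
      · by_cases h3 : k + 1 = n
        · subst h3
          have h4 : ¬ k = k + 1 + 1 := by omega
          simp [op_apply_succ, h4, basisVec_apply,
            coord_add, coord_smul, -lp.coeFn_add, -lp.coeFn_smul, -Complex.coe_smul]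
        · have h4 : ¬ k + 2 = n + 1 := by omega
          simp [op_apply_succ, basisVec_apply,
            coord_add, coord_smul, -lp.coeFn_add, -lp.coeFn_smul, -Complex.coe_smul, h1, h2, h3, h4]

/-- The recurrence for P_n is the action of J on the basis solved for e_{n+1}. Since it has three
terms, the induction carries two consecutive indices. -/
theorem aeval_orthPoly_basisVec (n : ℕ) :
    Polynomial.aeval J.op (J.orthPoly n) (basisVec 0) = basisVec n ∧
      Polynomial.aeval J.op (J.orthPoly (n + 1)) (basisVec 0) = basisVec (n + 1) := by
  have hC : ∀ (r : ℝ) (u : EllTwo), (algebraMap ℝ (EllTwo →L[ℂ] EllTwo) r) u = (r : ℂ) • u := by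
    intro r u
    rw [Algebra.algebraMap_eq_smul_one]
    exact (Complex.coe_smul r u).symm
  have ha : ∀ n, (J.a n : ℂ) ≠ 0 := fun n => by exact_mod_cast (J.a_pos n).ne'
  induction n with
  | zero =>
    refine ⟨by simp [orthPoly], ?_⟩
    simp only [orthPoly, map_mul, map_sub, Polynomial.aeval_C, Polynomial.aeval_X,
      mul_apply_eq_comp, sub_apply, hC, op_basisVec_zero]
    rw [add_sub_cancel_left, smul_smul, Complex.ofReal_inv, inv_mul_cancel₀ (ha 0), one_smul]
  | succ n ih =>
    refine ⟨ih.2, ?_⟩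
    simp only [orthPoly, map_mul, map_sub, Polynomial.aeval_C, Polynomial.aeval_X,
      mul_apply_eq_comp, sub_apply, hC, ih.1, ih.2,
      op_basisVec_succ]
    rw [add_right_comm, add_sub_cancel_right, add_sub_cancel_left, smul_smul, Complex.ofReal_inv,
      inv_mul_cancel₀ (ha _), one_smul]

/-- `∫ f P_n P_m dρ = (f(J) e_m, e_n)`. -/
theorem integral_mul_orthPoly (f : C_c(ℝ, ℝ)) (n m : ℕ) :
    ∫ x, f x * ((J.orthPoly n).eval x * (J.orthPoly m).eval x) ∂J.spectralMeasure =
      cfcForm J.op f (basisVec n) (basisVec m) := by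
  have h := integral_vectorSpectralMeasure_mul_polynomial J.op_isSelfAdjoint (basisVec 0) f
    (J.orthPoly n) (J.orthPoly m)
  exact h.trans (congrArg₂ (cfcForm J.op f) (J.aeval_orthPoly_basisVec n).1
    (J.aeval_orthPoly_basisVec m).1)

/-- The Fourier coefficients of `cos θ ^ k`. -/
noncomputable def cosMoment (k : ℕ) (m : ℤ) : ℝ :=
  1 / Real.pi * ∫ t in (0 : ℝ)..Real.pi, Real.cos t ^ k * Real.cos (m * t)

theorem cosMoment_zero (m : ℤ) : cosMoment 0 m = if m = 0 then 1 else 0 := by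
  rw [cosMoment]
  split_ifs with h
  · subst h
    simp [Real.pi_ne_zero]
  · have h' : (m : ℝ) ≠ 0 := by exact_mod_cast h
    simp [intervalIntegral.integral_comp_mul_left (fun t => Real.cos t) h', Real.sin_int_mul_pi]

/-- From 2 cos t cos mt = cos (m-1)t + cos (m+1)t. Together with the initial values at k = 0, this
says that the numbers are the matrix elements, at index difference m, of the k-th power of the free
Jacobi matrix on ℤ with off-diagonal entries 1/2. -/
theorem cosMoment_succ (k : ℕ) (m : ℤ) :
    cosMoment (k + 1) m = 1 / 2 * cosMoment k (m - 1) + 1 / 2 * cosMoment k (m + 1) := by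
  have hi : ∀ m : ℤ, IntervalIntegrable (fun t => Real.cos t ^ k * Real.cos (m * t))
      volume 0 Real.pi := fun m => Continuous.intervalIntegrable (by fun_prop) _ _
  have h : ∫ t in (0 : ℝ)..Real.pi, Real.cos t ^ (k + 1) * Real.cos (m * t) =
      1 / 2 * ((∫ t in (0 : ℝ)..Real.pi, Real.cos t ^ k * Real.cos ((m - 1 : ℤ) * t)) +
        ∫ t in (0 : ℝ)..Real.pi, Real.cos t ^ k * Real.cos ((m + 1 : ℤ) * t)) := by
    rw [← intervalIntegral.integral_add (hi _) (hi _), ← intervalIntegral.integral_const_mul]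
    refine intervalIntegral.integral_congr fun t _ => ?_
    have e1 : ((m - 1 : ℤ) : ℝ) * t = m * t - t := by push_cast; ring
    have e2 : ((m + 1 : ℤ) : ℝ) * t = m * t + t := by push_cast; ring
    simp only [e1, e2, Real.cos_add, Real.cos_sub]
    ring
  rw [cosMoment, h, cosMoment, cosMoment]
  ring

/-- An entry of a power of J far down the diagonal involves only nearby coefficients, which tend to
those of the free matrix; one factor J at a time reproduces the recurrence of `cosMoment_succ`. -/
theorem tendsto_inner_pow (ha : Tendsto J.a atTop (𝓝 (1 / 2))) (hb : Tendsto J.b atTop (𝓝 0))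
    (k i j : ℕ) :
    Tendsto (fun n => (inner ℂ (basisVec (n + i)) ((J.op ^ k) (basisVec (n + j)))).re) atTop
      (𝓝 (cosMoment k (i - j))) := by
  induction k generalizing i j with
  | zero =>
    refine tendsto_const_nhds.congr fun n => ?_
    rw [cosMoment_zero, pow_zero, one_apply_eq_self, inner_basisVec_left,
      basisVec_apply]
    by_cases h : i = j
    · simp [h]
    · have : ((i : ℤ) - j) ≠ 0 := by omega
      simp [h, this]
  | succ k ih =>
    -- The column is n + (j + 1), so that its left neighbour is again of the form n + j. The column
    -- n + 0 is recovered below by replacing n with n + 1.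
    have key : ∀ i j : ℕ, Tendsto (fun n => (inner ℂ (basisVec (n + i))
        ((J.op ^ (k + 1)) (basisVec (n + (j + 1))))).re) atTop
        (𝓝 (cosMoment (k + 1) (i - (j + 1 : ℕ)))) := by
      intro i j
      have hA : ∀ j, Tendsto (fun n => J.a (n + j)) atTop (𝓝 (1 / 2)) :=
        fun j => (tendsto_add_atTop_iff_nat j).2 ha
      have hB : Tendsto (fun n => J.b (n + (j + 1))) atTop (𝓝 0) :=
        (tendsto_add_atTop_iff_nat (j + 1)).2 hb
      have h := (((hA j).mul (ih i j)).add (hB.mul (ih i (j + 1)))).add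
        ((hA (j + 1)).mul (ih i (j + 2)))
      have e : 1 / 2 * cosMoment k (i - j) + 0 * cosMoment k (i - (j + 1 : ℕ)) +
          1 / 2 * cosMoment k (i - (j + 2 : ℕ)) = cosMoment (k + 1) (i - (j + 1 : ℕ)) := by
        rw [cosMoment_succ]
        have e1 : (i : ℤ) - (j + 1 : ℕ) - 1 = i - (j + 2 : ℕ) := by push_cast; ring
        have e2 : (i : ℤ) - (j + 1 : ℕ) + 1 = i - j := by push_cast; ring
        rw [e1, e2]
        ring
      rw [e] at h
      refine h.congr fun n => ?_
      rw [pow_succ, mul_apply_eq_comp, ← add_assoc n j 1, op_basisVec_succ]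
      simp only [map_add, map_smul, inner_add_right, inner_smul_right, Complex.add_re,
        Complex.re_ofReal_mul]
      rfl
    rcases j with _ | j
    · have h := key (i + 1) 0
      have e : ((i + 1 : ℕ) : ℤ) - (0 + 1 : ℕ) = i - (0 : ℕ) := by push_cast; ring
      rw [e] at h
      refine (tendsto_add_atTop_iff_nat 1).1 (h.congr fun n => ?_)
      rw [show n + (i + 1) = n + 1 + i by ring, show n + (0 + 1) = n + 1 + 0 by ring]
    · exact key i j

/-- The matrix elements `(f(J) e_{n+1}, e_{n+1}) - (f(J) e_{n+2}, e_n)`. -/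
noncomputable def turanForm (f : ℝ → ℝ) (n : ℕ) : ℝ :=
  cfcForm J.op f (basisVec (n + 1)) (basisVec (n + 1)) -
    cfcForm J.op f (basisVec (n + 0)) (basisVec (n + 2))

theorem turanForm_add {f g : ℝ → ℝ} (hf : Continuous f) (hg : Continuous g) (n : ℕ) :
    J.turanForm (fun x => f x + g x) n = J.turanForm f n + J.turanForm g n := by
  simp only [turanForm, cfcForm_add _ hf hg]
  ring

theorem abs_turanForm_le {f : ℝ → ℝ} {C : ℝ} (hC : 0 ≤ C)
    (h : ∀ x ∈ spectrum ℝ J.op, |f x| ≤ C) (n : ℕ) : |J.turanForm f n| ≤ 2 * C := by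
  have hi : ∀ n m, |cfcForm J.op f (basisVec n) (basisVec m)| ≤ C := fun n m =>
    (abs_cfcForm_le J.op hC h _ _).trans_eq (by rw [norm_basisVec, norm_basisVec]; ring)
  calc _ ≤ _ := abs_sub _ _
    _ ≤ C + C := add_le_add (hi _ _) (hi _ _)
    _ = 2 * C := by ring

/-- For a monomial the two matrix elements tend to Fourier coefficients of orders 0 and -2, and 1 -
cos 2t = 2 sin² t. -/
theorem tendsto_turanForm_polynomial (ha : Tendsto J.a atTop (𝓝 (1 / 2)))
    (hb : Tendsto J.b atTop (𝓝 0)) (p : Polynomial ℝ) :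
    Tendsto (J.turanForm (fun x => p.eval x)) atTop
      (𝓝 (2 / Real.pi * ∫ t in (0 : ℝ)..Real.pi, p.eval (Real.cos t) * Real.sin t ^ 2)) := by
  induction p using Polynomial.induction_on' with
  | add p q hp hq =>
    have e : ∫ t in (0 : ℝ)..Real.pi, (p + q).eval (Real.cos t) * Real.sin t ^ 2 =
        (∫ t in (0 : ℝ)..Real.pi, p.eval (Real.cos t) * Real.sin t ^ 2) +
          ∫ t in (0 : ℝ)..Real.pi, q.eval (Real.cos t) * Real.sin t ^ 2 := by
      rw [← intervalIntegral.integral_add]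
      · simp only [Polynomial.eval_add, add_mul]
      · exact Continuous.intervalIntegrable (by fun_prop) _ _
      · exact Continuous.intervalIntegrable (by fun_prop) _ _
    rw [e, mul_add]
    refine (hp.add hq).congr fun n => ?_
    rw [← turanForm_add _ p.continuous q.continuous]
    simp only [Polynomial.eval_add]
  | monomial k r =>
    have hm : ∀ n m, cfcForm J.op (fun x => (Polynomial.monomial k r).eval x) (basisVec n)
        (basisVec m) = r * (inner ℂ (basisVec n) ((J.op ^ k) (basisVec m))).re := by
      intro n m
      rw [cfcForm_polynomial J.op_isSelfAdjoint, Polynomial.aeval_monomial, ← Algebra.smul_def]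
      change (inner ℂ (basisVec n) (r • (J.op ^ k) (basisVec m))).re = _
      rw [inner_smul_right_eq_smul, Complex.smul_re, smul_eq_mul]
    have h := ((J.tendsto_inner_pow ha hb k 1 1).const_mul r).sub
      ((J.tendsto_inner_pow ha hb k 0 2).const_mul r)
    have e : r * cosMoment k ((1 : ℕ) - (1 : ℕ)) - r * cosMoment k ((0 : ℕ) - (2 : ℕ)) =
        2 / Real.pi * ∫ t in (0 : ℝ)..Real.pi,
          (Polynomial.monomial k r).eval (Real.cos t) * Real.sin t ^ 2 := by
      rw [← mul_sub, cosMoment, cosMoment, ← mul_sub, ← intervalIntegral.integral_sub]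
      · have : ∀ r s I : ℝ, r * (1 / s * I) = 2 / s * (r / 2 * I) := fun r s I => by ring
        rw [this, ← intervalIntegral.integral_const_mul]
        congr 1
        refine intervalIntegral.integral_congr fun t _ => ?_
        simp only [Polynomial.eval_monomial, Real.sin_sq]
        have e1 : ((((1 : ℕ) : ℤ) - (1 : ℕ) : ℤ) : ℝ) * t = 0 := by simp
        have e2 : ((((0 : ℕ) : ℤ) - (2 : ℕ) : ℤ) : ℝ) * t = -(2 * t) := by push_cast; ring
        rw [e1, e2, Real.cos_neg, Real.cos_two_mul, Real.cos_zero]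
        ring
      · exact Continuous.intervalIntegrable (by fun_prop) _ _
      · exact Continuous.intervalIntegrable (by fun_prop) _ _
    rw [e] at h
    refine h.congr fun n => ?_
    rw [turanForm, hm, hm]

theorem tendsto_turanForm (ha : Tendsto J.a atTop (𝓝 (1 / 2)))
    (hb : Tendsto J.b atTop (𝓝 0)) {f : ℝ → ℝ} (hf : Continuous f) :
    Tendsto (J.turanForm f) atTop
      (𝓝 (2 / Real.pi * ∫ t in (0 : ℝ)..Real.pi, f (Real.cos t) * Real.sin t ^ 2)) := by
  obtain ⟨M, hM⟩ := (spectrum.isCompact (𝕜 := ℝ) J.op).isBounded.exists_norm_le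
  rw [Metric.tendsto_atTop]
  intro e he
  -- The interval contains both the spectrum, where the matrix elements are estimated, and [-1, 1],
  -- where the limit integral lives. The three errors add up to at most e/4 + e/4 + e/4.
  obtain ⟨p, hp⟩ := exists_polynomial_near_of_continuousOn (-(|M| + 1)) (|M| + 1) f
    hf.continuousOn (e / 8) (by positivity)
  obtain ⟨N, hN⟩ := Metric.tendsto_atTop.1 (J.tendsto_turanForm_polynomial ha hb p) (e / 4)
    (by positivity)
  refine ⟨N, fun n hn => ?_⟩
  have h1 := hN n hn
  have h2 : |J.turanForm (fun x => f x - p.eval x) n| ≤ 2 * (e / 8) := by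
    refine J.abs_turanForm_le (by positivity) (fun x hx => ?_) n
    have hx' := abs_le.1 ((hM x hx).trans (le_abs_self M))
    rw [abs_sub_comm]
    exact (hp x ⟨by linarith [hx'.1], by linarith [hx'.2]⟩).le
  have h3 : J.turanForm f n =
      J.turanForm (fun x => p.eval x) n + J.turanForm (fun x => f x - p.eval x) n := by
    have hq : Continuous fun x => f x - p.eval x := hf.sub p.continuous
    rw [← turanForm_add _ p.continuous hq]
    simp
  have h4 : ‖∫ t in (0 : ℝ)..Real.pi, (f (Real.cos t) - p.eval (Real.cos t)) * Real.sin t ^ 2‖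
      ≤ e / 8 * |Real.pi - 0| := by
    refine intervalIntegral.norm_integral_le_of_norm_le_const fun t _ => ?_
    rw [norm_mul, Real.norm_eq_abs, Real.norm_eq_abs, abs_of_nonneg (sq_nonneg (Real.sin t)),
      abs_sub_comm]
    have h5 := hp (Real.cos t) ⟨by linarith [Real.neg_one_le_cos t, abs_nonneg M],
      by linarith [Real.cos_le_one t, abs_nonneg M]⟩
    calc _ ≤ e / 8 * 1 := mul_le_mul h5.le (Real.sin_sq_le_one t) (sq_nonneg _) (by positivity)
      _ = e / 8 := mul_one _
  have h6 : ∫ t in (0 : ℝ)..Real.pi, (f (Real.cos t) - p.eval (Real.cos t)) * Real.sin t ^ 2 =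
      (∫ t in (0 : ℝ)..Real.pi, f (Real.cos t) * Real.sin t ^ 2) -
        ∫ t in (0 : ℝ)..Real.pi, p.eval (Real.cos t) * Real.sin t ^ 2 := by
    rw [← intervalIntegral.integral_sub]
    · simp only [sub_mul]
    · exact Continuous.intervalIntegrable (by fun_prop) _ _
    · exact Continuous.intervalIntegrable (by fun_prop) _ _
  rw [h6, Real.norm_eq_abs, sub_zero, abs_of_pos Real.pi_pos] at h4
  have h7 : |2 / Real.pi * (∫ t in (0 : ℝ)..Real.pi, f (Real.cos t) * Real.sin t ^ 2) -
      2 / Real.pi * ∫ t in (0 : ℝ)..Real.pi, p.eval (Real.cos t) * Real.sin t ^ 2| ≤ e / 4 := by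
    rw [← mul_sub, abs_mul, abs_of_pos (div_pos two_pos Real.pi_pos)]
    calc _ ≤ 2 / Real.pi * (e / 8 * Real.pi) :=
          mul_le_mul_of_nonneg_left h4 (div_pos two_pos Real.pi_pos).le
      _ = e / 4 := by field_simp; ring
  rw [Real.dist_eq] at h1 ⊢
  rw [h3]
  rw [abs_lt] at h1 ⊢
  rw [abs_le] at h2 h7
  constructor <;> linarith [h1.1, h1.2, h2.1, h2.2, h7.1, h7.2]

theorem integral_cos_mul_sin_sq {f : ℝ → ℝ} (hf : Continuous f) :
    ∫ t in (0 : ℝ)..Real.pi, f (Real.cos t) * Real.sin t ^ 2 =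
      ∫ x in (-1 : ℝ)..1, f x * Real.sqrt (1 - x ^ 2) := by
  have h := intervalIntegral.integral_comp_mul_deriv (a := 0) (b := Real.pi) (f := Real.cos)
    (f' := fun t => -Real.sin t) (g := fun x => f x * Real.sqrt (1 - x ^ 2))
    (fun t _ => Real.hasDerivAt_cos t) (by fun_prop) (by fun_prop)
  rw [Real.cos_zero, Real.cos_pi] at h
  rw [intervalIntegral.integral_symm 1 (-1), ← h, ← intervalIntegral.integral_neg]
  refine intervalIntegral.integral_congr fun t ht => ?_
  rw [uIcc_of_le Real.pi_pos.le] at ht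
  have hs : Real.sqrt (1 - Real.cos t ^ 2) = Real.sin t := by
    rw [← Real.sin_sq, Real.sqrt_sq (Real.sin_nonneg_of_nonneg_of_le_pi ht.1 ht.2)]
  simp only [Function.comp_apply, hs]
  ring

/-- The Turán determinants `P_{n+1}² - P_n P_{n+2}`. -/
noncomputable def turan (n : ℕ) (x : ℝ) : ℝ :=
  (J.orthPoly (n + 1)).eval x ^ 2 - (J.orthPoly n).eval x * (J.orthPoly (n + 2)).eval x

theorem continuous_turan (n : ℕ) : Continuous (J.turan n) := by
  unfold turan
  fun_prop

instance : IsFiniteMeasure J.spectralMeasure :=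
  ⟨(vectorSpectralMeasure_univ_le _ _).trans_lt ENNReal.ofReal_lt_top⟩

theorem tendsto_integral_turan (ha : Tendsto J.a atTop (𝓝 (1 / 2)))
    (hb : Tendsto J.b atTop (𝓝 0)) (f : C_c(ℝ, ℝ)) :
    Tendsto (fun n => ∫ x, f x * J.turan n x ∂J.spectralMeasure) atTop
      (𝓝 (2 / Real.pi * ∫ x in (-1 : ℝ)..1, f x * Real.sqrt (1 - x ^ 2))) := by
  rw [← integral_cos_mul_sin_sq (map_continuous f)]
  refine (J.tendsto_turanForm ha hb (map_continuous f)).congr fun n => ?_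
  have hi : ∀ g : ℝ → ℝ, Continuous g → Integrable (fun x => f x * g x) J.spectralMeasure :=
    fun g hg => ((map_continuous f).mul hg).integrable_of_hasCompactSupport
      f.hasCompactSupport.mul_right
  have h1 := J.integral_mul_orthPoly f (n + 1) (n + 1)
  have h2 := J.integral_mul_orthPoly f n (n + 2)
  rw [turanForm]
  simp only [add_zero]
  refine ((congrArg₂ (· - ·) h1 h2).symm.trans ?_)
  rw [← integral_sub]
  · refine integral_congr_ae (Eventually.of_forall fun x => ?_)
    simp only [turan]
    ring
  · exact hi (fun x => (J.orthPoly (n + 1)).eval x * (J.orthPoly (n + 1)).eval x) (by fun_prop)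
  · exact hi (fun x => (J.orthPoly n).eval x * (J.orthPoly (n + 2)).eval x) (by fun_prop)

end JacobiMatrix

/-! ### Three-term recurrences with slowly varying coefficients -/

section Perturbation

/-- A summable perturbation of the trivial recurrence `y (n + 1) = y n` has a solution with any
prescribed limit. -/
theorem exists_seq_of_summable_perturbation {E : Type*} [NormedAddCommGroup E] [CompleteSpace E]
    {M : ℕ → E → E} {w : ℕ → ℝ} (hsub : ∀ n u v, M n u - M n v = M n (u - v))
    (hM : ∀ n u, ‖M n u‖ ≤ w n * ‖u‖) (hw0 : ∀ n, 0 ≤ w n) (hw : Summable w)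
    (hw2 : ∑' n, w n ≤ 1 / 2) (e : E) :
    ∃ y : ℕ → E, (∀ n, y (n + 1) = y n + M n (y n)) ∧
      ∀ n, ‖y n - e‖ ≤ 2 * ‖e‖ * ∑' m, w (n + m) := by
  have hwn : ∀ n, Summable fun m => w (n + m) := fun n => by
    simpa only [add_comm n] using (summable_nat_add_iff n).2 hw
  have htail : ∀ n, ∑' m, w (n + m) ≤ 1 / 2 := fun n => by
    refine le_trans ?_ hw2
    rw [← hw.sum_add_tsum_nat_add n]
    simp only [add_comm n]
    exact le_add_of_nonneg_left (Finset.sum_nonneg fun i _ => hw0 i)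
  have hb : ∀ (y : BoundedContinuousFunction ℕ E) (n m : ℕ),
      ‖M (n + m) (y (n + m))‖ ≤ w (n + m) * ‖y‖ := fun y n m =>
    (hM _ _).trans (mul_le_mul_of_nonneg_left (y.norm_coe_le_norm _) (hw0 _))
  have hs : ∀ (y : BoundedContinuousFunction ℕ E) (n : ℕ),
      Summable fun m => M (n + m) (y (n + m)) := fun y n =>
    Summable.of_norm_bounded ((hwn n).mul_right ‖y‖) (hb y n)
  have hle : ∀ (y : BoundedContinuousFunction ℕ E) (n : ℕ),
      ‖∑' m, M (n + m) (y (n + m))‖ ≤ (∑' m, w (n + m)) * ‖y‖ := fun y n => by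
    rw [← tsum_mul_right]
    exact tsum_of_norm_bounded ((hwn n).mul_right ‖y‖).hasSum (hb y n)
  have hle2 : ∀ (y : BoundedContinuousFunction ℕ E) (n : ℕ),
      ‖∑' m, M (n + m) (y (n + m))‖ ≤ 1 / 2 * ‖y‖ := fun y n =>
    (hle y n).trans (mul_le_mul_of_nonneg_right (htail n) (norm_nonneg _))
  -- Solutions with limit e are the fixed points of y_n = e - ∑_{m ≥ n} M_m y_m; total weight at
  -- most 1/2 makes the map a contraction of the bounded sequences.
  let T : BoundedContinuousFunction ℕ E → BoundedContinuousFunction ℕ E := fun y =>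
    BoundedContinuousFunction.ofNormedAddCommGroupDiscrete
      (fun n => e - ∑' m, M (n + m) (y (n + m))) (‖e‖ + 1 / 2 * ‖y‖)
      (fun n => (norm_sub_le _ _).trans (add_le_add le_rfl (hle2 y n)))
  have hT : ∀ y n, T y n = e - ∑' m, M (n + m) (y (n + m)) := fun y n => rfl
  have hc : ContractingWith (1 / 2) T := by
    refine ⟨by norm_num, LipschitzWith.of_dist_le_mul fun y z => ?_⟩
    rw [BoundedContinuousFunction.dist_le (by positivity)]
    intro n
    rw [dist_eq_norm, hT, hT, dist_eq_norm, sub_sub_sub_cancel_left, ← (hs z n).tsum_sub (hs y n)]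
    simp only [hsub]
    have := hle2 (z - y) n
    rw [norm_sub_rev y z]
    simpa using this
  refine ⟨fun n => hc.fixedPoint T n, fun n => ?_, fun n => ?_⟩
  all_goals
    have hfix : ∀ n, hc.fixedPoint T n =
        e - ∑' m, M (n + m) (hc.fixedPoint T (n + m)) := fun n => by
      conv_lhs => rw [← hc.fixedPoint_isFixedPt]
      rfl
  · dsimp only
    generalize hc.fixedPoint T = y at hfix
    have h1 := (hs y n).tsum_eq_zero_add
    have h2 : ∑' m, M (n + (m + 1)) (y (n + (m + 1))) = ∑' m, M (n + 1 + m) (y (n + 1 + m)) :=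
      tsum_congr fun m => by rw [add_right_comm, add_assoc]
    have h3 := hfix n
    rw [h1, h2, add_zero, eq_sub_iff_add_eq] at h3
    rw [hfix (n + 1), sub_eq_iff_eq_add, ← h3]
    abel
  · dsimp only
    generalize hc.fixedPoint T = y at hfix
    have hn : ‖y‖ ≤ ‖e‖ + 1 / 2 * ‖y‖ := by
      refine (BoundedContinuousFunction.norm_le (by positivity)).2 fun n => ?_
      rw [hfix n]
      exact (norm_sub_le _ _).trans (add_le_add le_rfl (hle2 y n))
    have h2 : ‖y‖ ≤ 2 * ‖e‖ := by linarith
    rw [hfix n, sub_sub_cancel_left, norm_neg, mul_comm]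
    exact (hle y n).trans (mul_le_mul_of_nonneg_left h2 (tsum_nonneg fun m => hw0 _))

theorem norm_inv_sub_inv_of_norm_eq_one {a b : ℂ} (ha : ‖a‖ = 1) (hb : ‖b‖ = 1) :
    ‖a⁻¹ - b⁻¹‖ = ‖a - b‖ := by
  have ha0 : a ≠ 0 := norm_ne_zero_iff.1 (by rw [ha]; exact one_ne_zero)
  have hb0 : b ≠ 0 := norm_ne_zero_iff.1 (by rw [hb]; exact one_ne_zero)
  rw [inv_sub_inv ha0 hb0, norm_div, norm_mul, ha, hb, mul_one, div_one, norm_sub_rev]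

/-- A three-term recurrence with slowly varying characteristic roots `ζ n`, `(ζ n)⁻¹` on the unit
circle has a solution which behaves as the product of the `ζ n`. -/
theorem exists_solution_of_slowly_varying {ζ : ℕ → ℂ} {z r : ℕ → ℂ} {ζ' : ℂ} {δ : ℝ} {w : ℕ → ℝ}
    (hδ : 0 < δ) (h1 : ∀ n, ‖ζ n‖ = 1) (hD : ∀ n, δ ≤ ‖(ζ n)⁻¹ - ζ n‖)
    (hlim : Tendsto ζ atTop (𝓝 ζ')) (hζ : ∀ n, ‖ζ (n + 1) - ζ n‖ ≤ w n)
    (hr : ∀ n, ‖1 - r n‖ ≤ w n) (hz : ∀ n, z n = ζ n + (ζ n)⁻¹) (hw : Summable w)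
    (hw2 : 4 / δ * ∑' n, w n ≤ 1 / 2) :
    ∃ F : ℕ → ℂ, (∀ n, F (n + 2) = z (n + 1) * F (n + 1) - r n * F n) ∧
      ∀ n, ‖F n / (∏ m ∈ Finset.range n, ζ m) - 1‖ ≤
        (32 / δ + 2) / δ * ∑' m, w (n + m) := by
  have h1' : ‖ζ'‖ = 1 := tendsto_nhds_unique hlim.norm (by simp only [h1]; exact tendsto_const_nhds)
  have h0 : ∀ n, ζ n ≠ 0 := fun n => norm_ne_zero_iff.1 (by rw [h1]; exact one_ne_zero)
  have h0' : ζ' ≠ 0 := norm_ne_zero_iff.1 (by rw [h1']; exact one_ne_zero)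
  have hw0 : ∀ n, 0 ≤ w n := fun n => (norm_nonneg _).trans (hr n)
  have hD0 : ∀ n, (ζ n)⁻¹ - ζ n ≠ 0 := fun n => norm_pos_iff.1 (hδ.trans_le (hD n))
  set q : ℕ → ℂ := fun n => ∏ m ∈ Finset.range n, ζ m with hq
  have hqs : ∀ n, q (n + 1) = q n * ζ n := fun n => Finset.prod_range_succ _ _
  have hq1 : ∀ n, ‖q n‖ = 1 := fun n => by
    simp [hq, norm_prod, h1]
  have hq0 : ∀ n, q n ≠ 0 := fun n => norm_ne_zero_iff.1 (by rw [hq1]; exact one_ne_zero)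
  -- Both `s` and `t` vanish for constant roots and r = 1, so they measure the variation of the
  -- coefficients.
  set s : ℕ → ℂ := fun n => (ζ n)⁻¹ - (ζ (n + 1))⁻¹ * r n with hs
  set t : ℕ → ℂ := fun n => ζ n - ζ (n + 1) * r n with ht
  have hsn : ∀ n, ‖s n‖ ≤ 2 * w n := fun n => by
    have e : s n = ((ζ n)⁻¹ - (ζ (n + 1))⁻¹) + (ζ (n + 1))⁻¹ * (1 - r n) := by
      simp only [hs]; ring
    rw [e]
    refine (norm_add_le _ _).trans ?_
    rw [norm_inv_sub_inv_of_norm_eq_one (h1 _) (h1 _), norm_mul, norm_inv, h1, norm_sub_rev]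
    linarith [hζ n, hr n]
  have htn : ∀ n, ‖t n‖ ≤ 2 * w n := fun n => by
    have e : t n = (ζ n - ζ (n + 1)) + ζ (n + 1) * (1 - r n) := by
      simp only [ht]; ring
    rw [e]
    refine (norm_add_le _ _).trans ?_
    rw [norm_mul, h1, norm_sub_rev]
    linarith [hζ n, hr n]
  -- Variation of parameters: the coordinates of a solution F are y₁ = q_{n+1}⁻¹ (F_{n+1} - ζ_n⁻¹
  -- F_n) and y₂ = q_{n+1} (F_{n+1} - ζ_n F_n), and `G` recovers F_n from them.
  let G : ℕ → ℂ × ℂ → ℂ := fun n u =>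
    (u.2 * (q (n + 1))⁻¹ - u.1 * q (n + 1)) / ((ζ n)⁻¹ - ζ n)
  have hG : ∀ n u, G n u = (u.2 * (q (n + 1))⁻¹ - u.1 * q (n + 1)) / ((ζ n)⁻¹ - ζ n) :=
    fun _ _ => rfl
  have hGn : ∀ n u, ‖G n u‖ ≤ 2 / δ * ‖u‖ := fun n u => by
    rw [hG, norm_div, div_le_iff₀ (norm_pos_iff.2 (hD0 n))]
    calc _ ≤ ‖u.2 * (q (n + 1))⁻¹‖ + ‖u.1 * q (n + 1)‖ := norm_sub_le _ _
      _ = ‖u.2‖ + ‖u.1‖ := by rw [norm_mul, norm_mul, norm_inv, hq1]; ring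
      _ ≤ 2 * ‖u‖ := by linarith [norm_fst_le u, norm_snd_le u]
      _ = 2 / δ * ‖u‖ * δ := by field_simp
      _ ≤ _ := mul_le_mul_of_nonneg_left (hD n) (by positivity)
  let M : ℕ → ℂ × ℂ → ℂ × ℂ := fun n u =>
    (s n * (q (n + 1))⁻¹ * G n u, t n * q (n + 1) * G n u)
  obtain ⟨y, hy, hye⟩ := exists_seq_of_summable_perturbation (M := M) (w := fun n => 4 / δ * w n)
    (fun n u v => by
      ext
      · simp only [M, G, Prod.fst_sub, Prod.snd_sub]; ring
      · simp only [M, G, Prod.fst_sub, Prod.snd_sub]; ring)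
    (fun n u => by
      have hb : ∀ c : ℂ, ‖c‖ ≤ 2 * w n → ‖c * G n u‖ ≤ 4 / δ * w n * ‖u‖ := fun c hc => by
        rw [norm_mul]
        calc _ ≤ 2 * w n * (2 / δ * ‖u‖) :=
              mul_le_mul hc (hGn n u) (norm_nonneg _) (mul_nonneg two_pos.le (hw0 n))
          _ = _ := by ring
      refine max_le (hb _ ?_) (hb _ ?_)
      · rw [norm_mul, norm_inv, hq1, inv_one, mul_one]; exact hsn n
      · rw [norm_mul, hq1, mul_one]; exact htn n)
    (fun n => mul_nonneg (by positivity) (hw0 n)) (hw.mul_left _)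
    -- The prescribed limit is that of the coordinates of q itself: y₂ = 0 and y₁ = 1 - ζ_n⁻², which
    -- tends to 1 - ζ'⁻² = -ζ'⁻¹ (ζ'⁻¹ - ζ').
    (by rw [tsum_mul_left]; exact hw2) (-(ζ'⁻¹ * (ζ'⁻¹ - ζ')), 0)
  have he : ‖((-(ζ'⁻¹ * (ζ'⁻¹ - ζ')), 0) : ℂ × ℂ)‖ ≤ 2 := by
    refine max_le ?_ (by simp)
    rw [norm_neg, norm_mul, norm_inv, h1', inv_one, one_mul]
    refine (norm_sub_le _ _).trans ?_
    rw [norm_inv, h1']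
    norm_num
  have hya : ∀ n, (y (n + 1)).1 = (y n).1 + s n * (q (n + 1))⁻¹ * G n (y n) := fun n => by
    rw [hy n]; rfl
  have hyb : ∀ n, (y (n + 1)).2 = (y n).2 + t n * q (n + 1) * G n (y n) := fun n => by
    rw [hy n]; rfl
  have hF0 : ∀ n, G n (y n) * ((ζ n)⁻¹ - ζ n) =
      (y n).2 * (q (n + 1))⁻¹ - (y n).1 * q (n + 1) := fun n => div_mul_cancel₀ _ (hD0 n)
  -- Consistency: F_{n+1} read off from the coordinates at n + 1 agrees with the value encoded at n.
  have hF1 : ∀ n, G (n + 1) (y (n + 1)) = q (n + 1) * (y n).1 + (ζ n)⁻¹ * G n (y n) := fun n => by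
    rw [hG (n + 1), div_eq_iff (hD0 _), hya, hyb, hqs (n + 1)]
    have hq' := hq0 (n + 1)
    have e1 : (y n).2 = (G n (y n) * ((ζ n)⁻¹ - ζ n) + (y n).1 * q (n + 1)) * q (n + 1) := by
      rw [hF0]; field_simp; ring
    rw [e1]
    simp only [hs, ht]
    have := h0 n
    have := h0 (n + 1)
    field_simp
    ring
  refine ⟨fun n => G n (y n), fun n => ?_, fun n => ?_⟩
  · dsimp only
    rw [hF1 (n + 1), hz, hqs (n + 1), hya]
    have e1 : (y n).1 = (q (n + 1))⁻¹ * (G (n + 1) (y (n + 1)) - (ζ n)⁻¹ * G n (y n)) := by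
      rw [hF1 n]
      have hq' := hq0 (n + 1)
      field_simp
      ring
    rw [e1]
    simp only [hs]
    have := h0 n
    have := h0 (n + 1)
    have := hq0 (n + 1)
    field_simp
    ring
  · set τ := ∑' m, w (n + m) with hτ
    have hτ0 : 0 ≤ τ := tsum_nonneg fun m => hw0 _
    have hdz : ‖ζ n - ζ'‖ ≤ τ := by
      rw [← dist_eq_norm]
      exact dist_le_tsum_of_dist_le_of_tendsto w
        (fun n => by rw [dist_comm, dist_eq_norm]; exact hζ n) hw hlim n
    have hyn : ‖y n - (-(ζ'⁻¹ * (ζ'⁻¹ - ζ')), 0)‖ ≤ 16 / δ * τ := by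
      refine (hye n).trans ?_
      rw [tsum_mul_left, ← hτ]
      calc _ ≤ 2 * 2 * (4 / δ * τ) := by
            refine mul_le_mul_of_nonneg_right ?_ (by positivity)
            linarith
        _ = _ := by ring
    have hyn1 := (norm_fst_le _).trans hyn
    have hyn2 := (norm_snd_le _).trans hyn
    simp only [Prod.fst_sub, Prod.snd_sub, sub_zero] at hyn1 hyn2
    -- The error splits into y₂, the deviation of y₁ from its limit, and the deviation of ζ_n⁻² from
    -- ζ'⁻²; each is bounded by a multiple of the tail of w.
    have e : G n (y n) / q n - 1 = ((y n).2 * (q (n + 1))⁻¹ * (q n)⁻¹ -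
        ((y n).1 - -(ζ'⁻¹ * (ζ'⁻¹ - ζ'))) * ζ n +
          ζ n * (ζ'⁻¹ + (ζ n)⁻¹) * (ζ'⁻¹ - (ζ n)⁻¹)) / ((ζ n)⁻¹ - ζ n) := by
      rw [hG, eq_div_iff (hD0 n), sub_mul, div_mul_eq_mul_div, div_mul_cancel₀ _ (hD0 n), hqs]
      have := h0 n
      have := hq0 n
      field_simp
      ring
    rw [e, norm_div, div_le_iff₀ (norm_pos_iff.2 (hD0 n))]
    have b1 : ‖(y n).2 * (q (n + 1))⁻¹ * (q n)⁻¹‖ ≤ 16 / δ * τ := by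
      rw [norm_mul, norm_mul, norm_inv, norm_inv, hq1, hq1, inv_one, mul_one, mul_one]
      exact hyn2
    have b2 : ‖((y n).1 - -(ζ'⁻¹ * (ζ'⁻¹ - ζ'))) * ζ n‖ ≤ 16 / δ * τ := by
      rw [norm_mul, h1, mul_one]
      exact hyn1
    have b3 : ‖ζ n * (ζ'⁻¹ + (ζ n)⁻¹) * (ζ'⁻¹ - (ζ n)⁻¹)‖ ≤ 2 * τ := by
      rw [norm_mul, norm_mul, h1, one_mul, norm_inv_sub_inv_of_norm_eq_one h1' (h1 n),
        norm_sub_rev]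
      refine mul_le_mul ((norm_add_le _ _).trans ?_) hdz (norm_nonneg _) two_pos.le
      rw [norm_inv, norm_inv, h1, h1']
      norm_num
    calc _ ≤ 16 / δ * τ + 16 / δ * τ + 2 * τ :=
          (norm_add_le _ _).trans (add_le_add ((norm_sub_le _ _).trans (add_le_add b1 b2)) b3)
      _ = (32 / δ + 2) / δ * τ * δ := by field_simp; ring
      _ ≤ _ := mul_le_mul_of_nonneg_left (hD n) (by positivity)

end Perturbation

/-! ### Jost solutions at the upper edge -/

namespace JacobiMatrix

theorem edgeZeta_plus {u : ℝ} (hu : |u| ≤ 1) :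
    edgeZeta Edge.plus u = u - Complex.I * Real.sqrt (1 - u ^ 2) := by
  simp [edgeZeta, edgeSqrt, hu, Edge.sign]

theorem sqrt_one_sub_sq_mul_self {u : ℝ} (hu : |u| ≤ 1) :
    (Real.sqrt (1 - u ^ 2) : ℂ) * Real.sqrt (1 - u ^ 2) = 1 - u ^ 2 := by
  rw [← Complex.ofReal_mul, Real.mul_self_sqrt]
  · push_cast; ring
  · rw [← sq_abs]; nlinarith [abs_nonneg u]

theorem edgeZeta_plus_inv {u : ℝ} (hu : |u| ≤ 1) :
    (edgeZeta Edge.plus u)⁻¹ = u + Complex.I * Real.sqrt (1 - u ^ 2) := by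
  refine inv_eq_of_mul_eq_one_right ?_
  rw [edgeZeta_plus hu]
  linear_combination sqrt_one_sub_sq_mul_self hu -
    (Real.sqrt (1 - u ^ 2) : ℂ) * Real.sqrt (1 - u ^ 2) * Complex.I_sq

theorem norm_edgeZeta_plus {u : ℝ} (hu : |u| ≤ 1) : ‖edgeZeta Edge.plus u‖ = 1 := by
  rw [edgeZeta_plus hu, ← sq_eq_sq₀ (norm_nonneg _) zero_le_one, ← Complex.normSq_eq_norm_sq,
    Complex.normSq_apply]
  have h : 0 ≤ 1 - u ^ 2 := by rw [← sq_abs]; nlinarith [abs_nonneg u]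
  simp
  rw [Real.mul_self_sqrt h]
  ring

/-- The roots differ by 2i√(1-u²) and merge only at u = ±1. Staying away from these points is what
makes the later constants uniform. -/
theorem le_norm_edgeZeta_plus_inv_sub {u κ : ℝ} (hu : |u| ≤ κ) (hκ : κ < 1) :
    2 * Real.sqrt (1 - κ ^ 2) ≤ ‖(edgeZeta Edge.plus u)⁻¹ - edgeZeta Edge.plus u‖ := by
  have hu1 := hu.trans hκ.le
  rw [edgeZeta_plus_inv hu1, edgeZeta_plus hu1]
  have e : (u : ℂ) + Complex.I * Real.sqrt (1 - u ^ 2) - (u - Complex.I * Real.sqrt (1 - u ^ 2)) =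
      (2 * Real.sqrt (1 - u ^ 2) : ℝ) * Complex.I := by push_cast; ring
  rw [e, norm_mul, Complex.norm_I, mul_one, Complex.norm_real, Real.norm_eq_abs,
    abs_of_nonneg (by positivity)]
  refine mul_le_mul_of_nonneg_left (Real.sqrt_le_sqrt ?_) two_pos.le
  have : u ^ 2 ≤ κ ^ 2 := by rw [← sq_abs]; exact pow_le_pow_left₀ (abs_nonneg u) hu 2
  linarith

theorem norm_edgeZeta_plus_sub_le {u v κ : ℝ} (hu : |u| ≤ κ) (hv : |v| ≤ κ) (hκ : κ < 1) :
    ‖edgeZeta Edge.plus u - edgeZeta Edge.plus v‖ ≤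
      (1 + 1 / Real.sqrt (1 - κ ^ 2)) * |u - v| := by
  have hκ0 : 0 ≤ κ := (abs_nonneg u).trans hu
  have hS : 0 < Real.sqrt (1 - κ ^ 2) := Real.sqrt_pos.2 (by nlinarith)
  have hle : ∀ {u : ℝ}, |u| ≤ κ → u ^ 2 ≤ κ ^ 2 := fun {u} hu => by
    rw [← sq_abs]; exact pow_le_pow_left₀ (abs_nonneg u) hu 2
  have h1 : ∀ {u : ℝ}, |u| ≤ κ → Real.sqrt (1 - κ ^ 2) ≤ Real.sqrt (1 - u ^ 2) := fun {u} hu =>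
    Real.sqrt_le_sqrt (by linarith [hle hu])
  have hm : ∀ {u : ℝ}, |u| ≤ κ → Real.sqrt (1 - u ^ 2) * Real.sqrt (1 - u ^ 2) = 1 - u ^ 2 :=
    fun {u} hu => Real.mul_self_sqrt (by nlinarith [hle hu])
  rw [edgeZeta_plus (hu.trans hκ.le), edgeZeta_plus (hv.trans hκ.le)]
  have e : (u : ℂ) - Complex.I * Real.sqrt (1 - u ^ 2) - (v - Complex.I * Real.sqrt (1 - v ^ 2)) =
      (u - v : ℝ) - Complex.I * (Real.sqrt (1 - u ^ 2) - Real.sqrt (1 - v ^ 2) : ℝ) := by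
    push_cast; ring
  rw [e]
  refine (norm_sub_le _ _).trans ?_
  rw [norm_mul, Complex.norm_I, one_mul, Complex.norm_real, Complex.norm_real, add_mul, one_mul]
  refine add_le_add le_rfl ?_
  rw [Real.norm_eq_abs, one_div_mul_eq_div, le_div_iff₀ hS]
  have e2 : (Real.sqrt (1 - u ^ 2) - Real.sqrt (1 - v ^ 2)) *
      (Real.sqrt (1 - u ^ 2) + Real.sqrt (1 - v ^ 2)) = -((u + v) * (u - v)) := by
    linear_combination hm hu - hm hv
  have e3 := congrArg abs e2
  rw [abs_mul, abs_neg, abs_mul, abs_of_nonneg (add_nonneg (Real.sqrt_nonneg _)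
    (Real.sqrt_nonneg _))] at e3
  have h2 : |u + v| ≤ 2 := (abs_add_le u v).trans (by linarith)
  have h3 : |u + v| * |u - v| ≤ 2 * |u - v| := mul_le_mul_of_nonneg_right h2 (abs_nonneg _)
  have h4 := mul_le_mul_of_nonneg_left (add_le_add (h1 hu) (h1 hv))
    (abs_nonneg (Real.sqrt (1 - u ^ 2) - Real.sqrt (1 - v ^ 2)))
  linarith

variable (J : JacobiMatrix)

theorem variation_nonneg (n : ℕ) : 0 ≤ J.variation n :=
  add_nonneg (abs_nonneg _) (abs_nonneg _)

theorem tendsto_eps : Tendsto J.eps atTop (𝓝 0) := by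
  have h := tendsto_sum_nat_add J.variation
  simp only [add_comm _ (_ : ℕ)] at h
  exact h

theorem exists_uniform_bound (ha : Tendsto J.a atTop (𝓝 (1 / 2))) (hb : Tendsto J.b atTop (𝓝 0))
    {c d : ℝ} (hc : -1 < c) (hd : d < 1) :
    ∃ κ : ℝ, 0 ≤ κ ∧ κ < 1 ∧ (∀ x ∈ Icc c d, |x| ≤ κ) ∧
      ∀ᶠ n in atTop, 1 / 4 ≤ J.a n ∧ ∀ x ∈ Icc c d, |J.lam x n| ≤ κ := by
  -- The 0 keeps μ nonnegative even if the interval is empty. Since |λ_n| ≤ (μ + |b_n|) / (2a_n) → μ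
  -- < 1, the midpoint (1 + μ)/2 is an eventual bound for all x at once.
  set μ := max 0 (max (-c) d) with hμ
  have hμ0 : 0 ≤ μ := le_max_left _ _
  have hμ1 : μ < 1 := max_lt one_pos (max_lt (by linarith) hd)
  have hx : ∀ x ∈ Icc c d, |x| ≤ μ := fun x hx => abs_le'.2
    ⟨hx.2.trans ((le_max_right _ _).trans (le_max_right _ _)),
      (neg_le_neg hx.1).trans ((le_max_left _ _).trans (le_max_right _ _))⟩
  refine ⟨(1 + μ) / 2, by linarith, by linarith, fun x h => (hx x h).trans (by linarith), ?_⟩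
  have hlim : Tendsto (fun n => (μ + |J.b n|) / (2 * J.a n)) atTop (𝓝 μ) := by
    have h : Tendsto (fun n => (μ + |J.b n|) / (2 * J.a n)) atTop
        (𝓝 ((μ + |0|) / (2 * (1 / 2)))) :=
      (hb.abs.const_add μ).div (ha.const_mul 2) (by norm_num)
    simpa using h
  filter_upwards [hlim.eventually_le_const (show μ < (1 + μ) / 2 by linarith),
    ha.eventually_const_le (show (1 / 4 : ℝ) < 1 / 2 by norm_num)] with n h1 h2
  refine ⟨h2, fun x h => le_trans ?_ h1⟩
  rw [lam, abs_div, abs_of_pos (mul_pos two_pos (J.a_pos n))]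
  refine div_le_div_of_nonneg_right ((abs_sub _ _).trans ?_) (mul_pos two_pos (J.a_pos n)).le
  linarith [hx x h]

theorem tendsto_lam (ha : Tendsto J.a atTop (𝓝 (1 / 2))) (hb : Tendsto J.b atTop (𝓝 0)) (x : ℝ) :
    Tendsto (J.lam x) atTop (𝓝 x) := by
  have h : Tendsto (fun n => (x - J.b n) / (2 * J.a n)) atTop (𝓝 ((x - 0) / (2 * (1 / 2)))) :=
    (hb.const_sub x).div (ha.const_mul 2) (by norm_num)
  simp only [sub_zero, mul_one_div_cancel (two_ne_zero' ℝ), div_one] at h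
  exact h

/-- Subtract 2a_n λ_n = x - b_n from 2a_{n+1} λ_{n+1} = x - b_{n+1}; the factor 4 is 2 / (2 · 1/4).
-/
theorem abs_lam_succ_sub_le {x : ℝ} {n : ℕ} (h1 : 1 / 4 ≤ J.a (n + 1)) (h2 : |J.lam x n| ≤ 1) :
    |J.lam x (n + 1) - J.lam x n| ≤ 4 * J.variation n := by
  have ha := J.a_pos (n + 1)
  have ha' := (J.a_pos n).ne'
  have e : J.lam x (n + 1) - J.lam x n =
      (-(J.b (n + 1) - J.b n) - 2 * J.lam x n * (J.a (n + 1) - J.a n)) / (2 * J.a (n + 1)) := by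
    rw [eq_div_iff (by positivity)]
    simp only [lam]
    field_simp
    ring
  rw [e, abs_div, div_le_iff₀ (abs_pos.2 (by positivity)),
    abs_of_pos (by positivity : (0 : ℝ) < 2 * J.a (n + 1))]
  have hv := J.variation_nonneg n
  have h3 : |2 * J.lam x n * (J.a (n + 1) - J.a n)| ≤ 2 * |J.a (n + 1) - J.a n| := by
    rw [abs_mul, abs_mul, abs_two]
    exact mul_le_mul_of_nonneg_right (by linarith) (abs_nonneg _)
  calc _ ≤ |J.b (n + 1) - J.b n| + 2 * |J.a (n + 1) - J.a n| := by
        refine (abs_sub _ _).trans ?_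
        rw [abs_neg]
        linarith
    _ ≤ 2 * J.variation n := by
        rw [variation]; linarith [abs_nonneg (J.b (n + 1) - J.b n)]
    _ ≤ _ := by nlinarith

/-- A sequence satisfying the Jacobi equation from some index on can be modified at the lower
indices to a solution. -/
theorem exists_isSolution_of_eventually {z : ℂ} (N : ℕ) {g : ℕ → ℂ}
    (hg : ∀ n ≥ N, J.aShift n * g n + J.b n * g (n + 1) + J.aShift (n + 1) * g (n + 2) =
      z * g (n + 1)) :
    ∃ f, J.IsSolution z f ∧ ∀ n ≥ N, f n = g n := by
  induction N generalizing g with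
  | zero => exact ⟨g, fun n => hg n (Nat.zero_le _), fun _ _ => rfl⟩
  | succ N ih =>
    have ha : (J.aShift N : ℂ) ≠ 0 := by
      rcases N with _ | N
      · simp [aShift]
      · exact_mod_cast (J.a_pos N).ne'
    obtain ⟨f, hf, hfg⟩ := ih (g := Function.update g N
      ((z * g (N + 1) - J.b N * g (N + 1) - J.aShift (N + 1) * g (N + 2)) / J.aShift N))
      (fun n hn => by
        rw [Function.update_of_ne (by omega : n + 1 ≠ N),
          Function.update_of_ne (by omega : n + 2 ≠ N)]
        rcases eq_or_lt_of_le hn with rfl | hn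
        · rw [Function.update_self, mul_div_cancel₀ _ ha]
          ring
        · rw [Function.update_of_ne (by omega : n ≠ N)]
          exact hg n hn)
    exact ⟨f, hf, fun n hn => by rw [hfg n (by omega), Function.update_of_ne (by omega)]⟩

/-- The branch satisfies (√(u²-1))² = u² - 1; if it were equal to u, this would give 1 = 0. -/
theorem edgeZeta_ne_zero (s : Edge) (u : ℝ) : edgeZeta s u ≠ 0 := by
  intro h
  have h1 : edgeSqrt s u ^ 2 = u ^ 2 - 1 := by
    rw [edgeSqrt]
    have hs : (s.sign : ℂ) ^ 2 = 1 := by cases s <;> simp [Edge.sign]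
    split_ifs with h1 h2
    · rw [mul_pow, mul_pow, hs, Complex.I_sq, sq, sqrt_one_sub_sq_mul_self h1]
      ring
    · rw [← Complex.ofReal_pow, Real.sq_sqrt (by nlinarith)]
      push_cast; ring
    · rw [neg_sq, ← Complex.ofReal_pow, Real.sq_sqrt]
      · push_cast; ring
      · rw [not_le] at h1
        rw [← sq_abs]; nlinarith
  rw [edgeZeta, sub_eq_zero] at h
  rw [← h] at h1
  have : (1 : ℂ) = 0 := by linear_combination h1
  exact one_ne_zero this

theorem ansatz_ne_zero (s : Edge) (x : ℝ) (n : ℕ) : J.ansatz s x n ≠ 0 :=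
  Finset.prod_ne_zero_iff.2 fun _ _ => edgeZeta_ne_zero _ _

/-- Existence of the Jost solutions at the upper edge with an error uniform on compact subintervals
of `(-1, 1)`. -/
theorem exists_jost_uniform (ha : Tendsto J.a atTop (𝓝 (1 / 2))) (hb : Tendsto J.b atTop (𝓝 0))
    (hvar : Summable J.variation) {c d : ℝ} (hc : -1 < c) (hd : d < 1) :
    ∃ (C : ℝ) (N : ℕ), ∀ x ∈ Icc c d, ∃ f : ℕ → ℂ, J.IsSolution x f ∧
      ∀ n ≥ N, ‖f (n + 1) / J.ansatz Edge.plus x n - 1‖ ≤ C * J.eps n := by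
  obtain ⟨κ, hκ0, hκ1, -, hev⟩ := J.exists_uniform_bound ha hb hc hd
  set S := Real.sqrt (1 - κ ^ 2) with hS
  have hS0 : 0 < S := Real.sqrt_pos.2 (by nlinarith)
  -- The Lipschitz constant of ζ times the 4 of `abs_lam_succ_sub_le`; being at least 4, it also
  -- covers |1 - a_n / a_{n+1}|.
  set K := (1 + 1 / S) * 4 with hK
  have hK4 : 4 ≤ K := by
    have : 0 < 1 / S := by positivity
    linarith
  have hev2 : ∀ᶠ n in atTop, 4 / (2 * S) * (K * J.eps n) ≤ 1 / 2 := by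
    have h := (J.tendsto_eps.const_mul K).const_mul (4 / (2 * S))
    rw [mul_zero, mul_zero] at h
    exact h.eventually_le_const (by norm_num)
  -- From N on, for every x in the interval, the roots are separated and the perturbation has total
  -- weight at most 1/2.
  obtain ⟨N, hN⟩ := eventually_atTop.1 (hev.and hev2)
  refine ⟨(32 / (2 * S) + 2) / (2 * S) * K, N, fun x hx => ?_⟩
  have hl : ∀ n, |J.lam x (N + n)| ≤ κ := fun n => (hN _ (Nat.le_add_right _ _)).1.2 x hx
  have hl1 : ∀ n, |J.lam x (N + n)| ≤ 1 := fun n => (hl n).trans hκ1.le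
  have ha4 : ∀ n, 1 / 4 ≤ J.a (N + n) := fun n => (hN _ (Nat.le_add_right _ _)).1.1
  have hx1 : |x| ≤ κ := by
    refine le_of_tendsto (J.tendsto_lam ha hb x).abs ?_
    filter_upwards [eventually_ge_atTop N] with n hn using (hN n hn).1.2 x hx
  have hlim : Tendsto (fun n => edgeZeta Edge.plus (J.lam x (N + n))) atTop
      (𝓝 (edgeZeta Edge.plus x)) := by
    rw [tendsto_iff_norm_sub_tendsto_zero]
    have h := ((tendsto_add_atTop_iff_nat N).2 (J.tendsto_lam ha hb x))
    simp only [add_comm _ N] at h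
    have h2 := (tendsto_iff_norm_sub_tendsto_zero.1 h).const_mul (1 + 1 / S)
    rw [mul_zero] at h2
    exact squeeze_zero (fun _ => norm_nonneg _)
      (fun n => norm_edgeZeta_plus_sub_le (hl n) hx1 hκ1) h2
  obtain ⟨F, hF, hFn⟩ := exists_solution_of_slowly_varying
    (ζ := fun n => edgeZeta Edge.plus (J.lam x (N + n))) (z := fun n => 2 * J.lam x (N + n))
    (r := fun n => J.a (N + n) / J.a (N + n + 1)) (w := fun n => K * J.variation (N + n))
    (δ := 2 * S) (by positivity) (fun n => norm_edgeZeta_plus (hl1 n))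
    (fun n => le_norm_edgeZeta_plus_inv_sub (hl n) hκ1) hlim
    (fun n => by
      refine (norm_edgeZeta_plus_sub_le (hl (n + 1)) (hl n) hκ1).trans ?_
      rw [hK, mul_assoc]
      exact mul_le_mul_of_nonneg_left (J.abs_lam_succ_sub_le (ha4 (n + 1)) (hl1 n))
        (by positivity))
    (fun n => by
      have hp := J.a_pos (N + n + 1)
      have e : (1 : ℂ) - J.a (N + n) / J.a (N + n + 1) =
          (((J.a (N + n + 1) - J.a (N + n)) / J.a (N + n + 1) : ℝ) : ℂ) := by
        have : (J.a (N + n + 1) : ℂ) ≠ 0 := by exact_mod_cast hp.ne'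
        push_cast
        field_simp
      rw [e, Complex.norm_real, norm_div, Real.norm_eq_abs, Real.norm_eq_abs, abs_of_pos hp,
        div_le_iff₀ hp]
      have h4 : 1 / 4 ≤ J.a (N + n + 1) := ha4 (n + 1)
      have h5 : 1 ≤ K * J.a (N + n + 1) := by nlinarith
      have h6 := J.variation_nonneg (N + n)
      have h7 : |J.a (N + n + 1) - J.a (N + n)| ≤ J.variation (N + n) :=
        le_add_of_nonneg_right (abs_nonneg _)
      nlinarith)
    (fun n => by
      rw [edgeZeta_plus_inv (hl1 n), edgeZeta_plus (hl1 n)]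
      ring)
    (((summable_nat_add_iff N).2 hvar |>.congr fun n => by rw [add_comm]).mul_left K)
    (by rw [tsum_mul_left]; exact (hN N le_rfl).2)
  -- F_0 stands for f_N, stored at position N + 1; the factor q_N completes the product of the ζ's
  -- down to index 0.
  obtain ⟨f, hf, hfg⟩ := J.exists_isSolution_of_eventually (z := x) (N + 1)
    (g := fun k => J.ansatz Edge.plus x N * F (k - (N + 1))) (fun n hn => by
      obtain ⟨m, rfl⟩ := Nat.exists_eq_add_of_le hn
      have e1 : N + 1 + m - (N + 1) = m := by omega
      have e2 : N + 1 + m + 1 - (N + 1) = m + 1 := by omega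
      have e3 : N + 1 + m + 2 - (N + 1) = m + 2 := by omega
      rw [e1, e2, e3, hF m, show N + 1 + m = N + m + 1 by ring]
      have h0 : (J.a (N + m + 1) : ℂ) ≠ 0 := by exact_mod_cast (J.a_pos _).ne'
      simp only [aShift, lam, ← add_assoc]
      push_cast
      field_simp
      ring)
  refine ⟨f, hf, fun n hn => ?_⟩
  obtain ⟨m, rfl⟩ := Nat.exists_eq_add_of_le hn
  have h := hFn m
  have e : J.ansatz Edge.plus x (N + m) = J.ansatz Edge.plus x N *
      ∏ i ∈ Finset.range m, edgeZeta Edge.plus (J.lam x (N + i)) := Finset.prod_range_add _ _ _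
  rw [hfg _ (by omega), show N + m + 1 - (N + 1) = m by omega, e,
    mul_div_mul_left _ _ (J.ansatz_ne_zero _ _ _)]
  rw [tsum_mul_left] at h
  simpa only [eps, mul_assoc, add_assoc] using h

end JacobiMatrix

/-! ### Wronskians, uniqueness, and expansion of the orthogonal polynomials -/

namespace JacobiMatrix

open ComplexConjugate

theorem edgeZeta_minus (u : ℝ) : edgeZeta Edge.minus u = conj (edgeZeta Edge.plus u) := by
  rw [edgeZeta, edgeZeta, edgeSqrt, edgeSqrt]
  split_ifs <;> simp [Edge.sign]

theorem conj_edgeZeta_plus {u : ℝ} (hu : |u| ≤ 1) :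
    conj (edgeZeta Edge.plus u) = (edgeZeta Edge.plus u)⁻¹ := by
  rw [edgeZeta_plus_inv hu, edgeZeta_plus hu]
  simp

/-- Outside [-1, 1] the root is real with the sign of u, and the clamped values 0 and π of
`Real.arccos` are exactly its phase. -/
theorem edgeZeta_plus_eq_norm_mul_exp (u : ℝ) : edgeZeta Edge.plus u =
    ‖edgeZeta Edge.plus u‖ * Complex.exp (-(Complex.I * Real.arccos u)) := by
  by_cases hu : |u| ≤ 1
  · rw [norm_edgeZeta_plus hu, edgeZeta_plus hu, Complex.ofReal_one, one_mul,
      show -(Complex.I * Real.arccos u) = (-Real.arccos u : ℝ) * Complex.I by push_cast; ring,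
      Complex.exp_mul_I, ← Complex.ofReal_cos, ← Complex.ofReal_sin, Real.cos_neg, Real.sin_neg,
      Real.cos_arccos (abs_le.1 hu).1 (abs_le.1 hu).2, Real.sin_arccos]
    push_cast
    ring
  · by_cases h1 : 1 < u
    · have hs : Real.sqrt (u ^ 2 - 1) ≤ u := by
        rw [Real.sqrt_le_left (by linarith)]; linarith
      have e : edgeZeta Edge.plus u = (u - Real.sqrt (u ^ 2 - 1) : ℝ) := by
        rw [edgeZeta, edgeSqrt, if_neg hu, if_pos h1]; push_cast; rfl
      rw [Real.arccos_eq_zero.2 h1.le, e, Complex.norm_real, Real.norm_eq_abs,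
        abs_of_nonneg (sub_nonneg.2 hs)]
      simp
    · have h2 : u < -1 := by
        rw [not_le, lt_abs] at hu
        rcases hu with hu | hu
        · exact absurd hu h1
        · linarith
      have hs : Real.sqrt (u ^ 2 - 1) ≤ -u := by
        rw [Real.sqrt_le_left (by linarith)]; linarith [neg_sq u]
      have e : edgeZeta Edge.plus u = (u + Real.sqrt (u ^ 2 - 1) : ℝ) := by
        rw [edgeZeta, edgeSqrt, if_neg hu, if_neg h1]; push_cast; ring
      rw [Real.arccos_eq_pi.2 h2.le, e, Complex.norm_real, Real.norm_eq_abs,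
        abs_of_nonpos (by linarith), Complex.exp_neg, mul_comm Complex.I, Complex.exp_pi_mul_I]
      push_cast
      ring

theorem sqrt_one_sub_sq_pos {x : ℝ} (hx : x ∈ Ioo (-1 : ℝ) 1) : 0 < Real.sqrt (1 - x ^ 2) :=
  Real.sqrt_pos.2 (by nlinarith [hx.1, hx.2])

variable (J : JacobiMatrix)

theorem ansatz_minus (x : ℝ) (n : ℕ) :
    J.ansatz Edge.minus x n = conj (J.ansatz Edge.plus x n) := by
  simp only [ansatz, map_prod, edgeZeta_minus]

theorem ansatz_succ (s : Edge) (x : ℝ) (n : ℕ) :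
    J.ansatz s x (n + 1) = J.ansatz s x n * edgeZeta s (J.lam x n) := Finset.prod_range_succ _ _

theorem phase_succ (x : ℝ) (n : ℕ) : J.phase x (n + 1) = J.phase x n + J.theta x n :=
  Finset.sum_range_succ _ _

theorem ansatz_plus_eq_norm_mul_exp (x : ℝ) (n : ℕ) : J.ansatz Edge.plus x n =
    ‖J.ansatz Edge.plus x n‖ * Complex.exp (-(Complex.I * J.phase x n)) := by
  induction n with
  | zero => simp [ansatz, phase]
  | succ n ih =>
    rw [ansatz_succ, norm_mul, phase_succ]
    conv_lhs => rw [ih, edgeZeta_plus_eq_norm_mul_exp]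
    rw [theta]
    push_cast
    rw [mul_add, neg_add, Complex.exp_add]
    ring

/-- Factors with |λ_m| ≤ 1 have modulus 1, so the support is finite and `finprod` does not take its
default value. -/
theorem normFactor_eq {x : ℝ} {n : ℕ} (h : ∀ m ≥ n, |J.lam x m| ≤ 1) :
    J.normFactor x = ‖J.ansatz Edge.plus x n‖ := by
  rw [ansatz, norm_prod, normFactor]
  refine finprod_eq_prod_of_mulSupport_subset _ fun m hm => ?_
  by_contra hmn
  refine hm (norm_edgeZeta_plus (h m ?_))
  simpa using hmn

variable {J} in
theorem IsSolution.conj {x : ℝ} {f : ℕ → ℂ} (hf : J.IsSolution x f) :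
    J.IsSolution x fun n => conj (f n) := fun n => by
  simpa using congrArg (starRingEnd ℂ) (hf n)

variable {J} in
theorem IsSolution.sub {z : ℂ} {f g : ℕ → ℂ} (hf : J.IsSolution z f) (hg : J.IsSolution z g) :
    J.IsSolution z fun n => f n - g n := fun n => by
  linear_combination hf n - hg n

variable {J} in
theorem IsSolution.const_mul {z : ℂ} {f : ℕ → ℂ} (c : ℂ) (hf : J.IsSolution z f) :
    J.IsSolution z fun n => c * f n := fun n => by
  linear_combination c * hf n

variable {J} in
/-- The linear relation between three solutions. -/
theorem wronskian_mul_add {z : ℂ} {f g h : ℕ → ℂ} (hf : J.IsSolution z f)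
    (hg : J.IsSolution z g) (hh : J.IsSolution z h) (n : ℕ) :
    J.wronskian g h * f n = J.wronskian f h * g n - J.wronskian f g * h n := by
  rw [← J.wronskian_eq hg hh n, ← J.wronskian_eq hf hh n, ← J.wronskian_eq hf hg n]
  ring

theorem isJost_minus_of_plus {x : ℝ} {f : ℕ → ℂ} (hf : J.IsJost Edge.plus x f) :
    J.IsJost Edge.minus x fun n => conj (f n) := by
  refine ⟨hf.1.conj, ?_⟩
  have h := (Complex.continuous_conj.tendsto 1).comp hf.2
  rw [map_one] at h
  refine h.congr fun n => ?_
  simp [ansatz_minus]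

theorem isJost_plus_of_minus {x : ℝ} {f : ℕ → ℂ} (hf : J.IsJost Edge.minus x f) :
    J.IsJost Edge.plus x fun n => conj (f n) := by
  refine ⟨hf.1.conj, ?_⟩
  have h := (Complex.continuous_conj.tendsto 1).comp hf.2
  rw [map_one] at h
  refine h.congr fun n => ?_
  simp [ansatz_minus]

section Interior

variable (ha : Tendsto J.a atTop (𝓝 (1 / 2))) (hb : Tendsto J.b atTop (𝓝 0))
variable {x : ℝ} (hx : x ∈ Ioo (-1 : ℝ) 1)

include ha hb hx

theorem tendsto_edgeZeta_lam : Tendsto (fun n => edgeZeta Edge.plus (J.lam x n)) atTop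
    (𝓝 (edgeZeta Edge.plus x)) := by
  obtain ⟨κ, hκ0, hκ1, hκ, hev⟩ := J.exists_uniform_bound ha hb hx.1 hx.2
  have hxx : x ∈ Icc x x := ⟨le_rfl, le_rfl⟩
  rw [tendsto_iff_norm_sub_tendsto_zero]
  have h2 := (tendsto_iff_norm_sub_tendsto_zero.1 (J.tendsto_lam ha hb x)).const_mul
    (1 + 1 / Real.sqrt (1 - κ ^ 2))
  rw [mul_zero] at h2
  refine squeeze_zero' (Eventually.of_forall fun _ => norm_nonneg _) ?_ h2
  filter_upwards [hev] with n hn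
  exact norm_edgeZeta_plus_sub_le (hn.2 x hxx) (hκ x hxx) hκ1

theorem eventually_normFactor : ∀ᶠ n in atTop, J.normFactor x = ‖J.ansatz Edge.plus x n‖ := by
  obtain ⟨κ, hκ0, hκ1, hκ, hev⟩ := J.exists_uniform_bound ha hb hx.1 hx.2
  obtain ⟨N, hN⟩ := eventually_atTop.1 hev
  filter_upwards [eventually_ge_atTop N] with n hn
  exact J.normFactor_eq fun m hm => ((hN m (hn.trans hm)).2 x ⟨le_rfl, le_rfl⟩).trans hκ1.le

theorem normFactor_pos : 0 < J.normFactor x := by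
  obtain ⟨n, hn⟩ := (J.eventually_normFactor ha hb hx).exists
  rw [hn]
  exact norm_pos_iff.2 (J.ansatz_ne_zero _ _ _)

theorem tendsto_norm_ansatz :
    Tendsto (fun n => ‖J.ansatz Edge.plus x n‖) atTop (𝓝 (J.normFactor x)) :=
  tendsto_const_nhds.congr' (J.eventually_normFactor ha hb hx)

/-- The Wronskian is constant, so it may be computed at infinity: a_n → 1/2, f_n ~ q_n, q_{n+1} =
q_n ζ_n and |q_n| → k give k² (ζ⁻¹ - ζ)/2 with ζ⁻¹ - ζ = 2i√(1-x²). -/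
theorem wronskian_conj_of_isJost {f : ℕ → ℂ} (hf : J.IsJost Edge.plus x f) :
    J.wronskian f (fun n => conj (f n)) =
      Complex.I * J.normFactor x ^ 2 * Real.sqrt (1 - x ^ 2) := by
  have hx1 : |x| ≤ 1 := abs_le.2 ⟨hx.1.le, hx.2.le⟩
  set u : ℕ → ℂ := fun n => f (n + 1) / J.ansatz Edge.plus x n with hu
  have hu1 : Tendsto u atTop (𝓝 1) := hf.2
  have hus := (tendsto_add_atTop_iff_nat 1).2 hu1
  have hc : ∀ {v : ℕ → ℂ} {l : ℂ}, Tendsto v atTop (𝓝 l) →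
      Tendsto (fun n => conj (v n)) atTop (𝓝 (conj l)) := fun h =>
    (Complex.continuous_conj.tendsto _).comp h
  have hζ := J.tendsto_edgeZeta_lam ha hb hx
  have hac : Tendsto (fun n => (J.a n : ℂ)) atTop (𝓝 ((1 / 2 : ℝ) : ℂ)) :=
    (Complex.continuous_ofReal.tendsto _).comp ha
  have hk : Tendsto (fun n => (‖J.ansatz Edge.plus x n‖ : ℂ)) atTop (𝓝 (J.normFactor x)) :=
    (Complex.continuous_ofReal.tendsto _).comp (J.tendsto_norm_ansatz ha hb hx)
  have hL := (hac.mul (hk.pow 2)).mul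
    (((hu1.mul (hc hus)).mul (hc hζ)).sub ((hus.mul (hc hu1)).mul hζ))
  have hcst : ∀ n, (J.a n : ℂ) * (‖J.ansatz Edge.plus x n‖ : ℂ) ^ 2 *
      (u n * conj (u (n + 1)) * conj (edgeZeta Edge.plus (J.lam x n)) -
        u (n + 1) * conj (u n) * edgeZeta Edge.plus (J.lam x n)) =
      J.wronskian f (fun n => conj (f n)) := fun n => by
    have hF : ∀ n, f (n + 1) = J.ansatz Edge.plus x n * u n := fun n => by
      rw [hu]
      exact (mul_div_cancel₀ _ (J.ansatz_ne_zero _ _ _)).symm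
    rw [← J.wronskian_eq hf.1 hf.1.conj (n + 1), ← Complex.mul_conj', hF n, hF (n + 1),
      ansatz_succ]
    simp only [map_mul, aShift]
    ring
  have h := tendsto_nhds_unique (hL.congr hcst) tendsto_const_nhds
  rw [← h, map_one, conj_edgeZeta_plus hx1, edgeZeta_plus_inv hx1, edgeZeta_plus hx1]
  push_cast
  ring

theorem wronskian_conj_ne_zero {f : ℕ → ℂ} (hf : J.IsJost Edge.plus x f) :
    J.wronskian f (fun n => conj (f n)) ≠ 0 := by
  rw [J.wronskian_conj_of_isJost ha hb hx hf]
  have h1 := (J.normFactor_pos ha hb hx).ne'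
  have h2 := (sqrt_one_sub_sq_pos hx).ne'
  simp [h1, h2, Complex.I_ne_zero]

omit hb hx in
theorem wronskian_eq_zero_of_tendsto {h g : ℕ → ℂ} (hh : J.IsSolution x h)
    (hg : J.IsSolution x g) (h0 : Tendsto (fun n => h (n + 1)) atTop (𝓝 0)) {B : ℝ}
    (hB : ∀ᶠ n in atTop, ‖g (n + 1)‖ ≤ B) : J.wronskian h g = 0 := by
  have hac : Tendsto (fun n => (J.a n : ℂ)) atTop (𝓝 ((1 / 2 : ℝ) : ℂ)) :=
    (Complex.continuous_ofReal.tendsto _).comp ha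
  have hbd : ∀ {v : ℕ → ℂ}, (∀ᶠ n in atTop, ‖v n‖ ≤ B) → IsBoundedUnder (· ≤ ·) atTop (norm ∘ v) :=
    fun h => isBoundedUnder_of_eventually_le h
  have h1 := h0.zero_mul_isBoundedUnder_le (hbd ((tendsto_add_atTop_nat 1).eventually hB))
  have h2 := ((tendsto_add_atTop_iff_nat 1).2 h0).zero_mul_isBoundedUnder_le (hbd hB)
  have h3 := hac.mul (h1.sub h2)
  rw [sub_zero, mul_zero] at h3
  exact tendsto_nhds_unique (tendsto_const_nhds.congr fun n =>
    (J.wronskian_eq hh hg (n + 1)).symm) h3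

/-- As |q_n| converges, the difference of two Jost solutions tends to 0. Its Wronskians with the
bounded solutions f and conj f then vanish, and these two span all solutions. -/
theorem isJost_plus_unique {f g : ℕ → ℂ} (hf : J.IsJost Edge.plus x f)
    (hg : J.IsJost Edge.plus x g) : f = g := by
  have hb1 : ∀ᶠ n in atTop, ‖f (n + 1)‖ ≤ J.normFactor x + 1 := by
    have h1 := hf.2.norm.mul (J.tendsto_norm_ansatz ha hb hx)
    rw [norm_one, one_mul] at h1
    filter_upwards [h1.eventually_le_const (lt_add_one _)] with n hn
    rwa [← norm_mul, div_mul_cancel₀ _ (J.ansatz_ne_zero _ _ _)] at hn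
  have h0 : Tendsto (fun n => f (n + 1) - g (n + 1)) atTop (𝓝 0) := by
    have h1 := (hf.2.sub hg.2).norm.mul (J.tendsto_norm_ansatz ha hb hx)
    rw [sub_self, norm_zero, zero_mul] at h1
    refine tendsto_zero_iff_norm_tendsto_zero.2 (h1.congr fun n => ?_)
    rw [← norm_mul, sub_mul, div_mul_cancel₀ _ (J.ansatz_ne_zero _ _ _),
      div_mul_cancel₀ _ (J.ansatz_ne_zero _ _ _)]
  have hh := hf.1.sub hg.1
  have w1 := J.wronskian_eq_zero_of_tendsto ha hh hf.1 h0 hb1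
  have w2 := J.wronskian_eq_zero_of_tendsto ha hh hf.1.conj h0 (B := J.normFactor x + 1)
    (by simpa using hb1)
  funext n
  have h := wronskian_mul_add hh hf.1 hf.1.conj n
  rw [w1, w2, zero_mul, zero_mul, sub_zero] at h
  exact sub_eq_zero.1
    ((mul_eq_zero.1 h).resolve_left (J.wronskian_conj_ne_zero ha hb hx hf))

theorem existsUnique_isJost (hvar : Summable J.variation) (s : Edge) :
    ∃! f : ℕ → ℂ, J.IsJost s x f := by
  obtain ⟨C, N, h⟩ := J.exists_jost_uniform ha hb hvar hx.1 hx.2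
  obtain ⟨f, hf, hfn⟩ := h x ⟨le_rfl, le_rfl⟩
  have hJ : J.IsJost Edge.plus x f := by
    refine ⟨hf, tendsto_iff_norm_sub_tendsto_zero.2 ?_⟩
    have h0 := J.tendsto_eps.const_mul C
    rw [mul_zero] at h0
    refine squeeze_zero' (Eventually.of_forall fun _ => norm_nonneg _) ?_ h0
    filter_upwards [eventually_ge_atTop N] with n hn using hfn n hn
  cases s with
  | plus => exact ⟨f, hJ, fun g hg => J.isJost_plus_unique ha hb hx hg hJ⟩
  | minus =>
    refine ⟨_, J.isJost_minus_of_plus hJ, fun g hg => ?_⟩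
    have h := J.isJost_plus_unique ha hb hx (J.isJost_plus_of_minus hg) hJ
    funext n
    rw [← h, Complex.conj_conj]

theorem isJost_jost (hvar : Summable J.variation) (s : Edge) : J.IsJost s x (J.jost s x) := by
  have h : ∃ f, J.IsJost s x f := (J.existsUnique_isJost ha hb hx hvar s).exists
  rw [jost, dif_pos h]
  exact h.choose_spec

theorem normJost_minus (hvar : Summable J.variation) :
    J.normJost Edge.minus x = fun n => conj (J.normJost Edge.plus x n) := by
  have h := (J.existsUnique_isJost ha hb hx hvar Edge.minus).unique
    (J.isJost_jost ha hb hx hvar Edge.minus)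
    (J.isJost_minus_of_plus (J.isJost_jost ha hb hx hvar Edge.plus))
  funext n
  simp [normJost, h]

theorem isSolution_normJost (hvar : Summable J.variation) (s : Edge) :
    J.IsSolution x (J.normJost s x) :=
  (J.isJost_jost ha hb hx hvar s).1.const_mul _

theorem wronskian_normJost (hvar : Summable J.variation) :
    J.wronskian (J.normJost Edge.plus x) (J.normJost Edge.minus x) =
      Complex.I * Real.sqrt (1 - x ^ 2) := by
  have h := J.wronskian_conj_of_isJost ha hb hx (J.isJost_jost ha hb hx hvar Edge.plus)
  have hk : (J.normFactor x : ℂ) ≠ 0 := by exact_mod_cast (J.normFactor_pos ha hb hx).ne'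
  rw [J.normJost_minus ha hb hx hvar]
  have e : J.wronskian (J.normJost Edge.plus x) (fun n => conj (J.normJost Edge.plus x n)) =
      (J.normFactor x : ℂ)⁻¹ ^ 2 * J.wronskian (J.jost Edge.plus x)
        (fun n => conj (J.jost Edge.plus x n)) := by
    simp only [wronskian, normJost, map_mul, map_inv₀, Complex.conj_ofReal]
    ring
  rw [e, h]
  field_simp

theorem Omega_minus (hvar : Summable J.variation) :
    J.Omega Edge.minus x = conj (J.Omega Edge.plus x) := by
  rw [Omega, Omega, J.normJost_minus ha hb hx hvar]
  simp [wronskian, polySol]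

/-- The expansion of the orthogonal polynomials over the Jost solutions. -/
theorem orthPoly_eq (hvar : Summable J.variation) (n : ℕ) :
    Complex.I * Real.sqrt (1 - x ^ 2) * ((J.orthPoly n).eval x : ℝ) =
      J.Omega Edge.minus x * J.normJost Edge.plus x (n + 1) -
        J.Omega Edge.plus x * J.normJost Edge.minus x (n + 1) := by
  rw [← J.wronskian_normJost ha hb hx hvar]
  exact wronskian_mul_add (J.polySol_isSolution x) (J.isSolution_normJost ha hb hx hvar _)
    (J.isSolution_normJost ha hb hx hvar _) (n + 1)

/-- If 𝛀 vanished, the expansion over the Jost solutions would give P_0 = 0. -/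
theorem limitAmplitude_pos (hvar : Summable J.variation) : 0 < J.limitAmplitude x := by
  refine mul_pos two_pos (norm_pos_iff.2 fun h => ?_)
  have h1 := J.orthPoly_eq ha hb hx hvar 0
  rw [J.Omega_minus ha hb hx hvar, h] at h1
  have h2 := (sqrt_one_sub_sq_pos hx).ne'
  simp [orthPoly, h2] at h1

/-- Replacing the normalized Jost solution by e^{-iφ_n} in the expansion gives exactly ϰ sin(φ_n +
t). The replacement error enters twice, each time with a coefficient of modulus ϰ/2. -/
theorem orthPoly_sub_eq (hvar : Summable J.variation) {t : ℝ}
    (ht : ∀ s : Edge, -2 * J.Omega s x =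
      J.limitAmplitude x * Complex.exp (s.sign * Complex.I * t)) (n : ℕ) :
    |Real.sqrt (1 - x ^ 2) * (J.orthPoly n).eval x -
      J.limitAmplitude x * Real.sin (J.phase x n + t)| ≤ J.limitAmplitude x *
        ‖J.normJost Edge.plus x (n + 1) * Complex.exp (Complex.I * J.phase x n) - 1‖ := by
  set g := J.normJost Edge.plus x (n + 1) with hg
  set E := Complex.exp (Complex.I * J.phase x n) with hE
  set ϰ := J.limitAmplitude x with hϰ
  have hϰ0 : 0 < ϰ := J.limitAmplitude_pos ha hb hx hvar
  have h := J.orthPoly_eq ha hb hx hvar n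
  rw [J.normJost_minus ha hb hx hvar, ← hg] at h
  have hE0 : E ≠ 0 := Complex.exp_ne_zero _
  have hE1 : ‖E‖ = 1 := by rw [hE, mul_comm, Complex.norm_exp_ofReal_mul_I]
  have hEc : conj E = E⁻¹ := by
    rw [hE, ← Complex.exp_conj, ← Complex.exp_neg]; simp
  have hp := ht Edge.plus
  have hm := ht Edge.minus
  simp only [Edge.sign] at hp hm
  have hnp : ‖J.Omega Edge.plus x‖ = ϰ / 2 := by rw [hϰ, limitAmplitude]; ring
  have hnm : ‖J.Omega Edge.minus x‖ = ϰ / 2 := by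
    rw [J.Omega_minus ha hb hx hvar, RCLike.norm_conj, hnp]
  set T := Complex.exp (Complex.I * t) with hT
  have eT1 : Complex.exp ((1 : ℝ) * Complex.I * t) = T := by simp [hT]
  have eT2 : Complex.exp ((-1 : ℝ) * Complex.I * t) = T⁻¹ := by
    rw [hT, ← Complex.exp_neg]; simp
  rw [eT1] at hp
  rw [eT2] at hm
  have hsin : (Real.sin (J.phase x n + t) : ℂ) = (E⁻¹ * T⁻¹ - E * T) * Complex.I / 2 := by
    rw [Complex.ofReal_sin, Complex.sin, hE, hT, ← Complex.exp_neg, ← Complex.exp_neg,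
      ← Complex.exp_add, ← Complex.exp_add]
    push_cast
    ring_nf
  have e : Complex.I * ((Real.sqrt (1 - x ^ 2) * (J.orthPoly n).eval x -
      ϰ * Real.sin (J.phase x n + t) : ℝ) : ℂ) =
      J.Omega Edge.minus x * ((g * E - 1) * E⁻¹) -
        J.Omega Edge.plus x * conj ((g * E - 1) * E⁻¹) := by
    have hc : conj ((g * E - 1) * E⁻¹) = conj g - E := by
      simp only [map_mul, map_sub, map_inv₀, hEc, map_one]
      field_simp
    rw [hc, sub_mul, mul_assoc, mul_inv_cancel₀ hE0]
    simp only [Complex.ofReal_sub, Complex.ofReal_mul, hsin]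
    linear_combination h - E⁻¹ / 2 * hm + E / 2 * hp -
      ϰ * (E⁻¹ * T⁻¹ - E * T) / 2 * Complex.I_sq
  have e2 := congrArg norm e
  rw [norm_mul, Complex.norm_I, one_mul, Complex.norm_real, Real.norm_eq_abs] at e2
  rw [e2]
  refine (norm_sub_le _ _).trans_eq ?_
  simp only [norm_mul, RCLike.norm_conj, hnp, hnm, norm_inv, hE1]
  ring

end Interior

theorem exists_isLimitPhase (ha : Tendsto J.a atTop (𝓝 (1 / 2))) (hb : Tendsto J.b atTop (𝓝 0))
    (hvar : Summable J.variation) : ∃ η : ℝ → ℝ, J.IsLimitPhase η := by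
  refine ⟨fun x => Complex.arg (-2 * J.Omega Edge.plus x), fun x hx =>
    ⟨J.limitAmplitude_pos ha hb hx hvar, fun s => ?_⟩⟩
  have hn : J.limitAmplitude x = ‖-2 * J.Omega Edge.plus x‖ := by
    rw [limitAmplitude, norm_mul, norm_neg, Complex.norm_ofNat]
  have hp := Complex.norm_mul_exp_arg_mul_I (-2 * J.Omega Edge.plus x)
  cases s with
  | plus =>
    rw [hn]
    conv_lhs => rw [← hp]
    simp [Edge.sign, mul_comm]
  | minus =>
    have h := congrArg (starRingEnd ℂ) hp
    rw [hn, J.Omega_minus ha hb hx hvar]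
    simp only [map_mul, ← Complex.exp_conj, Complex.conj_ofReal, Complex.conj_I, map_neg,
      map_ofNat] at h
    rw [← h]
    simp [Edge.sign, mul_comm]

/-! ### Uniform asymptotics and the Turán determinants -/

section Uniform

variable (ha : Tendsto J.a atTop (𝓝 (1 / 2))) (hb : Tendsto J.b atTop (𝓝 0))
  (hvar : Summable J.variation) {c d : ℝ} (hc : -1 < c) (hd : d < 1)

include ha hb hvar hc hd

/-- Once all later λ_m lie in [-1, 1], k = |q_n| exactly, so the quantity is f_n / q_n and no new
error arises. -/
theorem exists_normJost_uniform : ∃ (C : ℝ) (N : ℕ), ∀ n ≥ N, ∀ x ∈ Icc c d,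
    ‖J.normJost Edge.plus x (n + 1) * Complex.exp (Complex.I * J.phase x n) - 1‖ ≤
      C * J.eps n := by
  obtain ⟨κ, hκ0, hκ1, hκ, hev⟩ := J.exists_uniform_bound ha hb hc hd
  obtain ⟨N₁, hN₁⟩ := eventually_atTop.1 hev
  obtain ⟨C, N₂, hf⟩ := J.exists_jost_uniform ha hb hvar hc hd
  refine ⟨C, max N₁ N₂, fun n hn x hx => ?_⟩
  have hx1 : x ∈ Ioo (-1 : ℝ) 1 := ⟨hc.trans_le hx.1, hx.2.trans_lt hd⟩
  obtain ⟨f, hfs, hfn⟩ := hf x hx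
  have hJ : J.IsJost Edge.plus x f := by
    refine ⟨hfs, tendsto_iff_norm_sub_tendsto_zero.2 ?_⟩
    have h0 := J.tendsto_eps.const_mul C
    rw [mul_zero] at h0
    refine squeeze_zero' (Eventually.of_forall fun _ => norm_nonneg _) ?_ h0
    filter_upwards [eventually_ge_atTop N₂] with n hn using hfn n hn
  have hjf := J.isJost_plus_unique ha hb hx1 (J.isJost_jost ha hb hx1 hvar Edge.plus) hJ
  have hk : J.normFactor x = ‖J.ansatz Edge.plus x n‖ := J.normFactor_eq fun m hm =>
    ((hN₁ m ((le_max_left _ _).trans (hn.trans hm))).2 x hx).trans hκ1.le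
  have e : J.normJost Edge.plus x (n + 1) * Complex.exp (Complex.I * J.phase x n) =
      f (n + 1) / J.ansatz Edge.plus x n := by
    have hk0 : (J.normFactor x : ℂ) ≠ 0 := by exact_mod_cast (J.normFactor_pos ha hb hx1).ne'
    rw [eq_div_iff (J.ansatz_ne_zero _ _ _), ansatz_plus_eq_norm_mul_exp, ← hk, normJost, hjf,
      Complex.exp_neg]
    have := Complex.exp_ne_zero (Complex.I * J.phase x n)
    field_simp
  rw [e]
  exact hfn n ((le_max_right _ _).trans hn)

/-- The Wronskian is evaluated at the fixed index N, where the Jost solution is uniformly controlled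
and only two polynomials remain to be bounded. -/
theorem exists_limitAmplitude_le : ∃ B : ℝ, ∀ x ∈ Icc c d, J.limitAmplitude x ≤ B := by
  obtain ⟨C, N, hCN⟩ := J.exists_normJost_uniform ha hb hvar hc hd
  have hg : ∀ n ≥ N, ∀ x ∈ Icc c d, ‖J.normJost Edge.plus x (n + 1)‖ ≤ 1 + C * J.eps n := by
    intro n hn x hx
    have h1 : ‖Complex.exp (Complex.I * J.phase x n)‖ = 1 := by
      rw [mul_comm, Complex.norm_exp_ofReal_mul_I]
    calc _ = ‖J.normJost Edge.plus x (n + 1) * Complex.exp (Complex.I * J.phase x n)‖ := by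
          rw [norm_mul, h1, mul_one]
      _ = ‖1 + (J.normJost Edge.plus x (n + 1) * Complex.exp (Complex.I * J.phase x n) - 1)‖ := by
          rw [add_sub_cancel]
      _ ≤ _ := (norm_add_le _ _).trans (by rw [norm_one]; linarith [hCN n hn x hx])
  have hP : ∀ n, ∃ B, ∀ x ∈ Icc c d, ‖(J.orthPoly n).eval x‖ ≤ B := fun n =>
    isCompact_Icc.exists_bound_of_continuousOn (J.orthPoly n).continuous.continuousOn
  obtain ⟨B₀, hB₀⟩ := hP N
  obtain ⟨B₁, hB₁⟩ := hP (N + 1)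
  refine ⟨2 * (J.a N * (B₀ * (1 + C * J.eps (N + 1)) + B₁ * (1 + C * J.eps N))), fun x hx => ?_⟩
  have hx1 : x ∈ Ioo (-1 : ℝ) 1 := ⟨hc.trans_le hx.1, hx.2.trans_lt hd⟩
  rw [limitAmplitude]
  refine mul_le_mul_of_nonneg_left ?_ two_pos.le
  rw [Omega, ← J.wronskian_eq (J.polySol_isSolution x)
    (J.isSolution_normJost ha hb hx1 hvar Edge.plus) (N + 1), norm_mul, aShift, Complex.norm_real,
    Real.norm_eq_abs, abs_of_pos (J.a_pos N)]
  refine mul_le_mul_of_nonneg_left ((norm_sub_le _ _).trans ?_) (J.a_pos N).le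
  rw [norm_mul, norm_mul, polySol, polySol, Complex.norm_real, Complex.norm_real]
  exact add_le_add
    (mul_le_mul (hB₀ x hx) (hg (N + 1) (by omega) x hx) (norm_nonneg _)
      ((norm_nonneg _).trans (hB₀ x hx)))
    (mul_le_mul (hB₁ x hx) (hg N le_rfl x hx) (norm_nonneg _) ((norm_nonneg _).trans (hB₁ x hx)))

/-- Asymptotics of the orthogonal polynomials in terms of the limit amplitude and phase. -/
theorem exists_orthPoly_asymptotics {η : ℝ → ℝ} (hη : J.IsLimitPhase η) :
    ∃ (C : ℝ) (N : ℕ), ∀ n ≥ N, ∀ x ∈ Icc c d, |(J.orthPoly n).eval x -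
      J.limitAmplitude x / Real.sqrt (1 - x ^ 2) * Real.sin (J.phase x n + η x)| ≤
        C * J.eps n := by
  obtain ⟨κ, hκ0, hκ1, hκ, -⟩ := J.exists_uniform_bound ha hb hc hd
  obtain ⟨C, N, hCN⟩ := J.exists_normJost_uniform ha hb hvar hc hd
  obtain ⟨B, hB⟩ := J.exists_limitAmplitude_le ha hb hvar hc hd
  set S := Real.sqrt (1 - κ ^ 2) with hS
  have hS0 : 0 < S := Real.sqrt_pos.2 (by nlinarith)
  refine ⟨B * C / S, N, fun n hn x hx => ?_⟩
  have hx1 : x ∈ Ioo (-1 : ℝ) 1 := ⟨hc.trans_le hx.1, hx.2.trans_lt hd⟩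
  have hs0 := sqrt_one_sub_sq_pos hx1
  have hSs : S ≤ Real.sqrt (1 - x ^ 2) := by
    refine Real.sqrt_le_sqrt ?_
    have : x ^ 2 ≤ κ ^ 2 := by rw [← sq_abs]; exact pow_le_pow_left₀ (abs_nonneg x) (hκ x hx) 2
    linarith
  have h := J.orthPoly_sub_eq ha hb hx1 hvar (hη x hx1).2 n
  have hϰ0 := (hη x hx1).1
  have h2 : J.limitAmplitude x *
      ‖J.normJost Edge.plus x (n + 1) * Complex.exp (Complex.I * J.phase x n) - 1‖ ≤
      B * (C * J.eps n) :=
    mul_le_mul (hB x hx) (hCN n hn x hx) (norm_nonneg _) (hϰ0.le.trans (hB x hx))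
  have e : (J.orthPoly n).eval x -
      J.limitAmplitude x / Real.sqrt (1 - x ^ 2) * Real.sin (J.phase x n + η x) =
      (Real.sqrt (1 - x ^ 2) * (J.orthPoly n).eval x -
        J.limitAmplitude x * Real.sin (J.phase x n + η x)) / Real.sqrt (1 - x ^ 2) := by
    field_simp
  rw [e, abs_div, abs_of_pos hs0, div_le_iff₀ hs0]
  have h3 := h.trans h2
  calc _ ≤ B * (C * J.eps n) := h3
    _ = B * C / S * J.eps n * S := by field_simp
    _ ≤ _ := by
      refine mul_le_mul_of_nonneg_left hSs ?_
      have h4 := (abs_nonneg _).trans h3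
      calc (0 : ℝ) ≤ B * (C * J.eps n) / S := div_nonneg h4 hS0.le
        _ = _ := by ring

omit hvar in
theorem eventually_abs_theta_sub_lt {e : ℝ} (he : 0 < e) :
    ∀ᶠ n in atTop, ∀ x ∈ Icc c d, |J.theta x n - Real.arccos x| < e := by
  obtain ⟨κ, hκ0, hκ1, hκ, hev⟩ := J.exists_uniform_bound ha hb hc hd
  have huc : UniformContinuousOn Real.arccos (Icc (-κ) κ) :=
    isCompact_Icc.uniformContinuousOn_of_continuous Real.continuous_arccos.continuousOn
  obtain ⟨δ, hδ, hδe⟩ := Metric.uniformContinuousOn_iff.1 huc e he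
  have hlim : Tendsto (fun n => (|1 - 2 * J.a n| + |J.b n|) / (2 * J.a n)) atTop
      (𝓝 ((|1 - 2 * (1 / 2)| + |0|) / (2 * (1 / 2)))) :=
    (((ha.const_mul 2).const_sub 1).abs.add hb.abs).div (ha.const_mul 2) (by norm_num)
  have h0 : (|1 - 2 * (1 / 2)| + |(0 : ℝ)|) / (2 * (1 / 2)) = 0 := by norm_num
  rw [h0] at hlim
  filter_upwards [hev, hlim.eventually_lt_const hδ] with n h1 h2 x hx
  refine hδe _ (abs_le.1 (h1.2 x hx)) _ (abs_le.1 (hκ x hx)) ?_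
  rw [Real.dist_eq]
  refine lt_of_le_of_lt ?_ h2
  have ha0 := J.a_pos n
  have e1 : J.lam x n - x = (x * (1 - 2 * J.a n) - J.b n) / (2 * J.a n) := by
    rw [lam]; field_simp; ring
  rw [e1, abs_div, abs_of_pos (mul_pos two_pos ha0)]
  refine div_le_div_of_nonneg_right ((abs_sub _ _).trans ?_) (mul_pos two_pos ha0).le
  rw [abs_mul]
  nlinarith [hκ x hx, abs_nonneg (1 - 2 * J.a n)]

/-- The Turán determinants converge to the square of the limit amplitude. -/
theorem tendstoUniformlyOn_turan :
    TendstoUniformlyOn J.turan (fun x => J.limitAmplitude x ^ 2) atTop (Icc c d) := by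
  obtain ⟨η, hη⟩ := J.exists_isLimitPhase ha hb hvar
  obtain ⟨κ, hκ0, hκ1, hκ, -⟩ := J.exists_uniform_bound ha hb hc hd
  obtain ⟨C, N, hCN⟩ := J.exists_orthPoly_asymptotics ha hb hvar hc hd hη
  obtain ⟨B₀, hB₀⟩ := J.exists_limitAmplitude_le ha hb hvar hc hd
  set S := Real.sqrt (1 - κ ^ 2) with hS
  have hS0 : 0 < S := Real.sqrt_pos.2 (by nlinarith)
  set B := |B₀| / S + 1 with hB
  have hB1 : 1 ≤ B := le_add_of_nonneg_left (by positivity)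
  rw [Metric.tendstoUniformlyOn_iff]
  intro e he
  -- Each of the two products in the determinant is off by at most 3Bδ, and 6Bδ < 8Bδ ≤ e; δ ≤ 1
  -- absorbs the quadratic error terms.
  set δ := min 1 (e / (8 * B)) with hδ
  have hδ0 : 0 < δ := lt_min one_pos (by positivity)
  have hδ1 : δ ≤ 1 := min_le_left _ _
  have hδe : δ * (8 * B) ≤ e := (le_div_iff₀ (by positivity)).1 (min_le_right _ _)
  have hE : ∀ᶠ n in atTop, C * J.eps n < δ / 2 := by
    have h := J.tendsto_eps.const_mul C
    rw [mul_zero] at h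
    exact h.eventually_lt_const (by positivity)
  have hT := J.eventually_abs_theta_sub_lt ha hb hc hd (e := δ / (2 * B)) (by positivity)
  obtain ⟨N₁, hN₁⟩ := eventually_atTop.1 (hE.and hT)
  filter_upwards [eventually_ge_atTop (max N N₁)] with n hn x hx
  have hnN : N ≤ n := (le_max_left _ _).trans hn
  have hnN₁ : N₁ ≤ n := (le_max_right _ _).trans hn
  have hx1 : x ∈ Ioo (-1 : ℝ) 1 := ⟨hc.trans_le hx.1, hx.2.trans_lt hd⟩
  have hs0 := sqrt_one_sub_sq_pos hx1
  have hSs : S ≤ Real.sqrt (1 - x ^ 2) := by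
    refine Real.sqrt_le_sqrt ?_
    have : x ^ 2 ≤ κ ^ 2 := by rw [← sq_abs]; exact pow_le_pow_left₀ (abs_nonneg x) (hκ x hx) 2
    linarith
  set A := J.limitAmplitude x / Real.sqrt (1 - x ^ 2) with hA
  have hϰ0 := (hη x hx1).1
  have hA0 : 0 < A := div_pos hϰ0 hs0
  have hAB : A ≤ B := by
    calc A ≤ |B₀| / S := div_le_div₀ (abs_nonneg _) ((hB₀ x hx).trans (le_abs_self _)) hS0 hSs
      _ ≤ B := (lt_add_one _).le
  set θ := Real.arccos x with hθ
  -- Since θ_n → θ uniformly, the phases at n, n + 1, n + 2 may be replaced by ψ - θ, ψ, ψ + θ.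
  set ψ := J.phase x (n + 1) + η x with hψ
  have hsinθ : A ^ 2 * Real.sin θ ^ 2 = J.limitAmplitude x ^ 2 := by
    rw [hθ, Real.sin_arccos, hA, div_pow, div_mul_cancel₀ _ (pow_ne_zero 2 hs0.ne')]
  have hsinlip : ∀ u v : ℝ, |u - v| < δ / (2 * B) → |A * Real.sin u - A * Real.sin v| ≤ δ / 2 := by
    intro u v huv
    rw [← mul_sub, abs_mul, abs_of_pos hA0]
    have h1 : |Real.sin u - Real.sin v| ≤ |u - v| := by
      simpa [Real.dist_eq] using Real.lipschitzWith_sin.dist_le_mul u v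
    calc _ ≤ B * (δ / (2 * B)) :=
          mul_le_mul hAB (h1.trans huv.le) (abs_nonneg _) (by linarith)
      _ = δ / 2 := by field_simp
  have p1 : |(J.orthPoly (n + 1)).eval x - A * Real.sin ψ| ≤ δ :=
    (hCN (n + 1) (by omega) x hx).trans
      ((hN₁ (n + 1) (by omega)).1.le.trans (by linarith))
  have p0 : |(J.orthPoly n).eval x - A * Real.sin (ψ - θ)| ≤ δ := by
    have h1 := (hCN n hnN x hx).trans (hN₁ n hnN₁).1.le
    have h2 := hsinlip (J.phase x n + η x) (ψ - θ) (by
      rw [hψ, phase_succ, show J.phase x n + η x - (J.phase x n + J.theta x n + η x - θ) =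
        -(J.theta x n - θ) by ring, abs_neg]
      exact (hN₁ n hnN₁).2 x hx)
    calc _ ≤ _ := abs_sub_le _ _ _
      _ ≤ δ / 2 + δ / 2 := add_le_add h1 h2
      _ = δ := add_halves δ
  have p2 : |(J.orthPoly (n + 2)).eval x - A * Real.sin (ψ + θ)| ≤ δ := by
    have h1 := (hCN (n + 2) (by omega) x hx).trans (hN₁ (n + 2) (by omega)).1.le
    have h2 := hsinlip (J.phase x (n + 2) + η x) (ψ + θ) (by
      rw [hψ, phase_succ, show J.phase x (n + 1) + J.theta x (n + 1) + η x -
        (J.phase x (n + 1) + η x + θ) = J.theta x (n + 1) - θ by ring]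
      exact (hN₁ (n + 1) (by omega)).2 x hx)
    calc _ ≤ _ := abs_sub_le _ _ _
      _ ≤ δ / 2 + δ / 2 := add_le_add h1 h2
      _ = δ := add_halves δ
  have hsb : ∀ u : ℝ, |A * Real.sin u| ≤ B := fun u => by
    rw [abs_mul, abs_of_pos hA0]
    calc _ ≤ A * 1 := mul_le_mul_of_nonneg_left (Real.abs_sin_le_one u) hA0.le
      _ ≤ B := by linarith
  have hprod : ∀ P Q p q : ℝ, |P - p| ≤ δ → |Q - q| ≤ δ → |p| ≤ B → |q| ≤ B →
      |P * Q - p * q| ≤ 3 * B * δ := by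
    intro P Q p q hP hQ hp hq
    have e1 : P * Q - p * q = (P - p) * (Q - q) + (P - p) * q + p * (Q - q) := by ring
    have i1 : |(P - p) * (Q - q)| ≤ δ * 1 := by
      rw [abs_mul]; exact mul_le_mul hP (hQ.trans hδ1) (abs_nonneg _) hδ0.le
    have i2 : |(P - p) * q| ≤ δ * B := by
      rw [abs_mul]; exact mul_le_mul hP hq (abs_nonneg _) hδ0.le
    have i3 : |p * (Q - q)| ≤ B * δ := by
      rw [abs_mul]; exact mul_le_mul hp hQ (abs_nonneg _) (by linarith)
    have i4 : δ * 1 ≤ δ * B := mul_le_mul_of_nonneg_left hB1 hδ0.le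
    rw [e1]
    calc _ ≤ |(P - p) * (Q - q)| + |(P - p) * q| + |p * (Q - q)| := abs_add_three _ _ _
      _ ≤ _ := by linarith
  -- The oscillation cancels: sin² ψ - sin(ψ - θ) sin(ψ + θ) = sin² θ, and A sin θ = ϰ.
  have hid : J.limitAmplitude x ^ 2 = A * Real.sin ψ * (A * Real.sin ψ) -
      A * Real.sin (ψ - θ) * (A * Real.sin (ψ + θ)) := by
    rw [← hsinθ, Real.sin_sub ψ θ, Real.sin_add ψ θ]
    linear_combination A ^ 2 * Real.sin ψ ^ 2 * Real.sin_sq_add_cos_sq θ -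
      A ^ 2 * Real.sin θ ^ 2 * Real.sin_sq_add_cos_sq ψ
  rw [dist_comm, Real.dist_eq, turan, hid, sq]
  have h1 := hprod _ _ _ _ p1 p1 (hsb ψ) (hsb ψ)
  have h2 := hprod _ _ _ _ p0 p2 (hsb (ψ - θ)) (hsb (ψ + θ))
  rw [sub_sub_sub_comm]
  calc _ ≤ _ := abs_sub _ _
    _ ≤ 3 * B * δ + 3 * B * δ := add_le_add h1 h2
    _ < e := by nlinarith

end Uniform

/-- A locally uniform limit of polynomials; continuity of the Jost solutions in x is not needed. -/
theorem continuousOn_limitAmplitude_sq (ha : Tendsto J.a atTop (𝓝 (1 / 2)))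
    (hb : Tendsto J.b atTop (𝓝 0)) (hvar : Summable J.variation) :
    ContinuousOn (fun x => J.limitAmplitude x ^ 2) (Ioo (-1) 1) := by
  intro x hx
  obtain ⟨c, hc, hcx⟩ := exists_between hx.1
  obtain ⟨d, hxd, hd⟩ := exists_between hx.2
  have h := (J.tendstoUniformlyOn_turan ha hb hvar hc hd).continuousOn
    (Frequently.of_forall fun n => (J.continuous_turan n).continuousOn)
  exact (h.continuousAt (Icc_mem_nhds hcx hxd)).continuousWithinAt

end JacobiMatrix

/-! ### Measures with a continuous density on an interval -/

section Density

theorem exists_Icc_of_isCompact_subset_Ioo {K : Set ℝ} (hK : IsCompact K) {l r : ℝ} (hlr : l < r)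
    (h : K ⊆ Ioo l r) : ∃ c d, l < c ∧ d < r ∧ K ⊆ Icc c d := by
  rcases K.eq_empty_or_nonempty with rfl | hne
  · exact ⟨r, l, hlr, hlr, empty_subset _⟩
  · obtain ⟨c, hc⟩ := hK.exists_isLeast hne
    obtain ⟨d, hd⟩ := hK.exists_isGreatest hne
    exact ⟨c, d, (h hc.1).1, (h hd.1).2, fun x hx => ⟨hc.2 hx, hd.2 hx⟩⟩

theorem continuous_mul_of_tsupport_subset {f v : ℝ → ℝ} {U : Set ℝ} (hU : IsOpen U)
    (hf : Continuous f) (hv : ContinuousOn v U) (hs : tsupport f ⊆ U) :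
    Continuous fun x => f x * v x := by
  refine continuous_of_tsupport fun x hx => hf.continuousAt.mul (hv.continuousAt (hU.mem_nhds ?_))
  exact hs (closure_mono (Function.support_mul_subset_left f v) hx)

variable {μ : Measure ℝ} [IsFiniteMeasure μ] {U : Set ℝ} {v : ℝ → ℝ}

/-- With a cutoff χ equal to 1 on K, both χ dμ and χ v dx are finite measures on the line with equal
integrals of bounded continuous functions, so they coincide. -/
theorem restrict_compact_eq_of_integral_eq (hU : IsOpen U) (hv : ContinuousOn v U)
    (h : ∀ f : C_c(ℝ, ℝ), tsupport f ⊆ U → ∫ x, f x ∂μ = ∫ x, f x * v x) (h0 : ∀ x ∈ U, 0 ≤ v x)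
    {K : Set ℝ} (hK : IsCompact K) (hKU : K ⊆ U) :
    μ.restrict K = (volume.withDensity fun x => ENNReal.ofReal (v x)).restrict K := by
  obtain ⟨χ, hχ1, hχc, hχU, hχ⟩ := exists_continuousMap_one_of_isCompact_subset_isOpen hK hU hKU
  have hχs : HasCompactSupport χ := hχc
  have hc : Continuous fun x => χ x * v x :=
    continuous_mul_of_tsupport_subset hU χ.continuous hv hχU
  have hcs : HasCompactSupport fun x => χ x * v x := hχs.mul_right
  have h0' : ∀ x, 0 ≤ χ x * v x := fun x => by
    by_cases hx : x ∈ tsupport χ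
    · exact mul_nonneg (hχ x).1 (h0 x (hχU hx))
    · rw [image_eq_zero_of_notMem_tsupport hx, zero_mul]
  have := isFiniteMeasure_withDensity_ofReal (μ := volume)
    (hc.integrable_of_hasCompactSupport hcs).2
  have := isFiniteMeasure_withDensity_ofReal (μ := μ)
    (χ.continuous.integrable_of_hasCompactSupport hχs).2
  have key : μ.withDensity (fun x => ENNReal.ofReal (χ x)) =
      volume.withDensity fun x => ENNReal.ofReal (χ x * v x) := by
    refine ext_of_forall_integral_eq_of_IsFiniteMeasure fun f => ?_
    rw [integral_withDensity_eq_integral_toReal_smul χ.continuous.measurable.ennreal_ofReal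
        (by simp),
      integral_withDensity_eq_integral_toReal_smul hc.measurable.ennreal_ofReal (by simp)]
    simp only [ENNReal.toReal_ofReal (h0' _), ENNReal.toReal_ofReal (hχ _).1, smul_eq_mul]
    let g : C_c(ℝ, ℝ) :=
      { toFun := fun x => χ x * f x
        continuous_toFun := χ.continuous.mul f.continuous
        hasCompactSupport' := hχs.mul_right }
    have hg := h g ((closure_mono (Function.support_mul_subset_left χ f)).trans hχU)
    refine hg.trans (integral_congr_ae (Eventually.of_forall fun x => ?_))
    change χ x * f x * v x = _
    ring
  have hm := hK.measurableSet
  have e1 : (μ.withDensity fun x => ENNReal.ofReal (χ x)).restrict K = μ.restrict K := by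
    rw [restrict_withDensity hm]
    conv_rhs => rw [← withDensity_one (μ := μ.restrict K)]
    refine withDensity_congr_ae ?_
    filter_upwards [ae_restrict_mem hm] with x hx
    simp [hχ1 hx]
  rw [← e1, key, restrict_withDensity hm, restrict_withDensity hm]
  refine withDensity_congr_ae ?_
  filter_upwards [ae_restrict_mem hm] with x hx
  simp [hχ1 hx]

/-- A finite measure which acts as `v dx` on the continuous functions with compact support in an
interval is equal to `v dx` on this interval. -/
theorem restrict_Ioo_eq_of_integral_eq {l r : ℝ} (hv : ContinuousOn v (Ioo l r))
    (h : ∀ f : C_c(ℝ, ℝ), tsupport f ⊆ Ioo l r → ∫ x, f x ∂μ = ∫ x, f x * v x)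
    (h0 : ∀ x ∈ Ioo l r, 0 ≤ v x) :
    μ.restrict (Ioo l r) =
      (volume.withDensity fun x => ENNReal.ofReal (v x)).restrict (Ioo l r) := by
  have hU : Ioo l r = ⋃ n : ℕ, Icc (l + 1 / ((n : ℝ) + 1)) (r - 1 / ((n : ℝ) + 1)) := by
    ext x
    simp only [mem_Ioo, mem_iUnion, mem_Icc]
    constructor
    · rintro ⟨h1, h2⟩
      obtain ⟨n, hn⟩ := exists_nat_one_div_lt (lt_min (sub_pos.2 h1) (sub_pos.2 h2))
      have := lt_min_iff.1 hn
      exact ⟨n, by linarith [this.1], by linarith [this.2]⟩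
    · rintro ⟨n, h1, h2⟩
      have : (0 : ℝ) < 1 / ((n : ℝ) + 1) := by positivity
      exact ⟨by linarith, by linarith⟩
  have hK : ∀ n : ℕ, Icc (l + 1 / ((n : ℝ) + 1)) (r - 1 / ((n : ℝ) + 1)) ⊆ Ioo l r := fun n => by
    rw [hU]; exact subset_iUnion (fun n : ℕ => Icc (l + 1 / ((n : ℝ) + 1)) (r - 1 / ((n : ℝ) + 1))) n
  have := fun n => restrict_compact_eq_of_integral_eq isOpen_Ioo hv h h0 isCompact_Icc (hK n)
  rw [hU]
  exact Measure.restrict_iUnion_congr.2 this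

/-- Starting the integral of v at an interior point c puts all mass up to c, whatever its nature,
into a constant and avoids integrability of v at l. -/
theorem hasDerivAt_measure_Iic {l r : ℝ} (hv : ContinuousOn v (Ioo l r))
    (h : μ.restrict (Ioo l r) =
      (volume.withDensity fun x => ENNReal.ofReal (v x)).restrict (Ioo l r))
    (h0 : ∀ x ∈ Ioo l r, 0 ≤ v x) {x : ℝ} (hx : x ∈ Ioo l r) :
    HasDerivAt (fun y => (μ (Iic y)).toReal) (v x) x := by
  obtain ⟨c, hc, hcx⟩ := exists_between hx.1
  have hvi : ∀ y ∈ Ioo c r, IntegrableOn v (Ioc c y) := fun y hy =>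
    ((hv.mono fun z hz => ⟨hc.trans_le hz.1, hz.2.trans_lt hy.2⟩).integrableOn_Icc
      (a := c) (b := y)).mono_set Ioc_subset_Icc_self
  have hF : ∀ y ∈ Ioo c r, (μ (Iic y)).toReal = (μ (Iic c)).toReal + ∫ t in c..y, v t := by
    intro y hy
    have hsub : Ioc c y ⊆ Ioo l r := fun z hz => ⟨hc.trans hz.1, hz.2.trans_lt hy.2⟩
    have h1 : μ (Ioc c y) = ∫⁻ t in Ioc c y, ENNReal.ofReal (v t) := by
      rw [← withDensity_apply _ measurableSet_Ioc, ← Measure.restrict_eq_self _ hsub, h,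
        Measure.restrict_eq_self _ hsub]
    have h2 : 0 ≤ᵐ[volume.restrict (Ioc c y)] v := by
      filter_upwards [ae_restrict_mem measurableSet_Ioc] with z hz using h0 z (hsub hz)
    rw [← Iic_union_Ioc_eq_Iic hy.1.le, measure_union (Iic_disjoint_Ioc le_rfl) measurableSet_Ioc,
      ENNReal.toReal_add (measure_ne_top _ _) (measure_ne_top _ _), h1,
      intervalIntegral.integral_of_le hy.1.le,
      integral_eq_lintegral_of_nonneg_ae h2 (hvi y hy).aestronglyMeasurable]
  have hd : HasDerivAt (fun y => (μ (Iic c)).toReal + ∫ t in c..y, v t) (v x) x := by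
    refine HasDerivAt.const_add _ (intervalIntegral.integral_hasDerivAt_right ?_
      (hv.stronglyMeasurableAtFilter isOpen_Ioo x hx) (hv.continuousAt (isOpen_Ioo.mem_nhds hx)))
    exact (intervalIntegrable_iff_integrableOn_Ioc_of_le hcx.le).2 (hvi x ⟨hcx, hx.2⟩)
  refine hd.congr_of_eventuallyEq ?_
  filter_upwards [isOpen_Ioo.mem_nhds (⟨hcx, hx.2⟩ : x ∈ Ioo c r)] with y hy using hF y hy

end Density

/-! ### The spectral density and the final amplitude -/

namespace JacobiMatrix

variable (J : JacobiMatrix)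

/-- The density `(2 / π) √(1 - x²) ϰ(x)⁻²` of the spectral measure on `(-1, 1)`. -/
noncomputable def density (x : ℝ) : ℝ :=
  2 / Real.pi * Real.sqrt (1 - x ^ 2) / J.limitAmplitude x ^ 2

section

variable (ha : Tendsto J.a atTop (𝓝 (1 / 2))) (hb : Tendsto J.b atTop (𝓝 0))
  (hvar : Summable J.variation)

include ha hb hvar

theorem density_pos {x : ℝ} (hx : x ∈ Ioo (-1 : ℝ) 1) : 0 < J.density x :=
  div_pos (mul_pos (div_pos two_pos Real.pi_pos) (sqrt_one_sub_sq_pos hx))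
    (pow_pos (J.limitAmplitude_pos ha hb hx hvar) 2)

theorem continuousOn_density : ContinuousOn J.density (Ioo (-1) 1) :=
  ContinuousOn.div (Continuous.continuousOn (by fun_prop))
    (J.continuousOn_limitAmplitude_sq ha hb hvar)
    fun _ hx => pow_ne_zero 2 (J.limitAmplitude_pos ha hb hx hvar).ne'

/-- The integrals of (f/ϰ²) D_n, with D_n the Turán determinants, have two limits: ∫ f dρ by uniform
convergence on the support of f, and the semicircle integral of f/ϰ² by the matrix elements of J. -/
theorem integral_spectralMeasure_eq (f : C_c(ℝ, ℝ)) (hf : tsupport f ⊆ Ioo (-1) 1) :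
    ∫ x, f x ∂J.spectralMeasure = ∫ x, f x * J.density x := by
  have hpos : ∀ x ∈ tsupport f, 0 < J.limitAmplitude x ^ 2 := fun x hx =>
    pow_pos (J.limitAmplitude_pos ha hb (hf hx) hvar) 2
  have hinv : ContinuousOn (fun x => (J.limitAmplitude x ^ 2)⁻¹) (Ioo (-1) 1) :=
    (J.continuousOn_limitAmplitude_sq ha hb hvar).inv₀
      fun _ hx => pow_ne_zero 2 (J.limitAmplitude_pos ha hb hx hvar).ne'
  let g : C_c(ℝ, ℝ) :=
    { toFun := fun x => f x * (J.limitAmplitude x ^ 2)⁻¹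
      continuous_toFun := continuous_mul_of_tsupport_subset isOpen_Ioo (map_continuous f) hinv hf
      hasCompactSupport' := f.hasCompactSupport.mul_right }
  have hg : ∀ x, g x = f x * (J.limitAmplitude x ^ 2)⁻¹ := fun _ => rfl
  have hg0 : ∀ x ∉ tsupport f, g x = 0 := fun x hx => by
    rw [hg, image_eq_zero_of_notMem_tsupport hx, zero_mul]
  have hgf : ∀ x, g x * J.limitAmplitude x ^ 2 = f x := fun x => by
    by_cases hx : x ∈ tsupport f
    · rw [hg, inv_mul_cancel_right₀ (hpos x hx).ne']
    · rw [hg0 x hx, image_eq_zero_of_notMem_tsupport hx, zero_mul]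
  obtain ⟨c, d, hc, hd, hcd⟩ := exists_Icc_of_isCompact_subset_Ioo f.hasCompactSupport
    (by norm_num) hf
  have hT := J.tendstoUniformlyOn_turan ha hb hvar hc hd
  have hlim : Tendsto (fun n => ∫ x, g x * J.turan n x ∂J.spectralMeasure) atTop
      (𝓝 (∫ x, f x ∂J.spectralMeasure)) := by
    -- Once |D_n - ϰ²| < 1 on the support, g D_n = f + g (D_n - ϰ²) is dominated by |f| + |g|.
    refine tendsto_integral_filter_of_dominated_convergence (fun x => |f x| + |g x|) ?_ ?_ ?_ ?_
    · exact Eventually.of_forall fun n =>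
        ((map_continuous g).mul (J.continuous_turan n)).aestronglyMeasurable
    · filter_upwards [Metric.tendstoUniformlyOn_iff.1 hT 1 one_pos] with n hn
      refine Eventually.of_forall fun x => ?_
      by_cases hx : x ∈ tsupport f
      · have h1 := hn x (hcd hx)
        rw [dist_comm, Real.dist_eq] at h1
        have e : g x * J.turan n x = f x + g x * (J.turan n x - J.limitAmplitude x ^ 2) := by
          rw [← hgf x]; ring
        rw [e, Real.norm_eq_abs]
        refine (abs_add_le _ _).trans (add_le_add le_rfl ?_)
        rw [abs_mul]
        exact mul_le_of_le_one_right (abs_nonneg _) h1.le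
      · rw [hg0 x hx, zero_mul, norm_zero]
        positivity
    · exact (f.integrable.abs).add g.integrable.abs
    · refine Eventually.of_forall fun x => ?_
      by_cases hx : x ∈ tsupport f
      · rw [← hgf x]
        exact (hT.tendsto_at (hcd hx)).const_mul _
      · rw [hg0 x hx, image_eq_zero_of_notMem_tsupport hx]
        simp
  rw [tendsto_nhds_unique hlim (J.tendsto_integral_turan ha hb g),
    intervalIntegral.integral_of_le (by norm_num), ← integral_const_mul,
    setIntegral_eq_integral_of_forall_compl_eq_zero]
  · refine integral_congr_ae (Eventually.of_forall fun x => ?_)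
    simp only [hg, density]
    ring
  · intro x hx
    rw [hg0 x fun h => hx (Ioo_subset_Ioc_self (hf h))]
    ring

theorem spectralMeasure_restrict : J.spectralMeasure.restrict (Ioo (-1) 1) =
    (volume.withDensity fun x => ENNReal.ofReal (J.density x)).restrict (Ioo (-1) 1) :=
  restrict_Ioo_eq_of_integral_eq (J.continuousOn_density ha hb hvar)
    (J.integral_spectralMeasure_eq ha hb hvar) fun _ hx => (J.density_pos ha hb hvar hx).le

theorem hasDerivAt_spectralDistribution {x : ℝ} (hx : x ∈ Ioo (-1 : ℝ) 1) :
    HasDerivAt J.spectralDistribution (J.density x) x :=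
  hasDerivAt_measure_Iic (J.continuousOn_density ha hb hvar)
    (J.spectralMeasure_restrict ha hb hvar) (fun _ hx => (J.density_pos ha hb hvar hx).le) hx

theorem weight_eq_density {x : ℝ} (hx : x ∈ Ioo (-1 : ℝ) 1) : J.weight x = J.density x :=
  (J.hasDerivAt_spectralDistribution ha hb hvar hx).deriv

/-- The formula for the density, solved for ϰ. -/
theorem amplitude_eq {x : ℝ} (hx : x ∈ Ioo (-1 : ℝ) 1) :
    (2 / Real.pi) ^ (1 / 2 : ℝ) * (1 - x ^ 2) ^ (-1 / 4 : ℝ) * J.weight x ^ (-1 / 2 : ℝ) =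
      J.limitAmplitude x / Real.sqrt (1 - x ^ 2) := by
  have hk := J.limitAmplitude_pos ha hb hx hvar
  have ht : 0 < 1 - x ^ 2 := by nlinarith [hx.1, hx.2]
  have hp : 0 < 2 / Real.pi := div_pos two_pos Real.pi_pos
  rw [J.weight_eq_density ha hb hvar hx, density]
  generalize J.limitAmplitude x = k at hk
  generalize 1 - x ^ 2 = t at ht
  generalize 2 / Real.pi = p at hp
  have e1 : (k ^ 2) ^ (-1 / 2 : ℝ) = k⁻¹ := by
    rw [← Real.rpow_natCast, ← Real.rpow_mul hk.le, ← Real.rpow_neg_one]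
    norm_num
  have e2 : (t ^ (1 / 2 : ℝ)) ^ (-1 / 2 : ℝ) = t ^ (-1 / 4 : ℝ) := by
    rw [← Real.rpow_mul ht.le]
    norm_num
  have e3 : p ^ (1 / 2 : ℝ) * p ^ (-1 / 2 : ℝ) = 1 := by
    rw [← Real.rpow_add hp]
    norm_num
  have e4 : t ^ (-1 / 4 : ℝ) * t ^ (-1 / 4 : ℝ) = (t ^ (1 / 2 : ℝ))⁻¹ := by
    rw [← Real.rpow_add ht, ← Real.rpow_neg ht.le]
    norm_num
  rw [Real.sqrt_eq_rpow, Real.div_rpow (by positivity) (by positivity),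
    Real.mul_rpow hp.le (by positivity), e1, e2]
  calc _ = p ^ (1 / 2 : ℝ) * p ^ (-1 / 2 : ℝ) * (t ^ (-1 / 4 : ℝ) * t ^ (-1 / 4 : ℝ)) * k := by
        field_simp
    _ = _ := by rw [e3, e4]; ring

end

end JacobiMatrix

theorem theorem5p8 (J : JacobiMatrix)
    (ha : Tendsto (fun n => J.a n - 1 / 2) atTop (𝓝 0))
    (hb : Tendsto J.b atTop (𝓝 0))
    (hvar : Summable J.variation) :
    -- the Jost solutions, the limit phase and the weight are well defined on `(-1, 1)`
    (∀ x ∈ Ioo (-1 : ℝ) 1, ∀ s : JacobiMatrix.Edge, ∃! f : ℕ → ℂ, J.IsJost s x f) ∧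
    (∃ η : ℝ → ℝ, J.IsLimitPhase η) ∧
    (∀ x ∈ Ioo (-1 : ℝ) 1, DifferentiableAt ℝ J.spectralDistribution x ∧ 0 < J.weight x) ∧
    J.spectralMeasure.restrict (Ioo (-1) 1) =
      (volume.restrict (Ioo (-1) 1)).withDensity (fun x => ENNReal.ofReal (J.weight x)) ∧
    -- the asymptotics, uniform on compact subintervals of `(-1, 1)`
    ∀ η : ℝ → ℝ, J.IsLimitPhase η → ∀ c d : ℝ, -1 < c → d < 1 →
      ∃ (C : ℝ) (N : ℕ), ∀ n ≥ N, ∀ x ∈ Icc c d,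
        |(J.orthPoly n).eval x -
          (2 / Real.pi) ^ (1 / 2 : ℝ) * (1 - x ^ 2) ^ (-1 / 4 : ℝ) * J.weight x ^ (-1 / 2 : ℝ) *
            Real.sin (J.phase x n + η x)| ≤ C * J.eps n := by
  have ha' : Tendsto J.a atTop (𝓝 (1 / 2)) := tendsto_sub_nhds_zero_iff.1 ha
  refine ⟨fun x hx s => J.existsUnique_isJost ha' hb hx hvar s,
    J.exists_isLimitPhase ha' hb hvar, fun x hx => ?_, ?_, fun η hη c d hc hd => ?_⟩
  · rw [J.weight_eq_density ha' hb hvar hx]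
    exact ⟨(J.hasDerivAt_spectralDistribution ha' hb hvar hx).differentiableAt,
      J.density_pos ha' hb hvar hx⟩
  · rw [J.spectralMeasure_restrict ha' hb hvar, restrict_withDensity measurableSet_Ioo]
    refine withDensity_congr_ae ?_
    filter_upwards [ae_restrict_mem measurableSet_Ioo] with x hx
    rw [J.weight_eq_density ha' hb hvar hx]
  · obtain ⟨C, N, h⟩ := J.exists_orthPoly_asymptotics ha' hb hvar hc hd hη
    refine ⟨C, N, fun n hn x hx => ?_⟩
    rw [J.amplitude_eq ha' hb hvar ⟨hc.trans_le hx.1, hx.2.trans_lt hd⟩]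
    exact h n hn x hx
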